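/- Let $G$ be a locally finite (simple, possibly infinite) graph and let $r \ge 3$ be an integer. Then the following are equivalent: 1. $G$ is $r$-locally chordal, i.e. for every vertex $v$ the ball $B_{r/2}(v)$ is chordal (each of its cycles of length at least four has a chord in it). Here $B_{r/2}(v)$ is the subgraph of $G$ whose vertex set $N^{r/2}[v]$ consists of all vertices of distance at most $r/2$ from $v$ and whose edges are all edges $xy$ of $G$ with $d_G(v,x)+d_G(v,y)<r$. 2. $G$ is an $r$-acyclic region intersection graph, i.e. there are a graph $H$ and nonempty connected subgraphs $H_v$ of $H$, one for each vertex $v$ of $G$, such that distinct vertices $u,v$ are adjacent in $G$ if and only if $H_u$ and $H_v$ have a common node, and such that $\bigcup_{x\in X} H_x$ is acyclic for every set $X$ of at most $r$ vertices of $G$. 3. $G$ admits a graph-decomposition into cliques with co-parts $(H_v)_{v\in V(G)}$ that is $r$-acyclic, i.e. $\bigcup_{x\in X} H_x$ is acyclic for every set $X$ of at most $r$ vertices of $G$. 4. $G$ admits a graph-decomposition into cliques with co-parts $(H_v)_{v\in V(G)}$ that $r$-locally induces tree-decompositions. 5. $G$ admits a graph-decomposition into cliques with co-parts $(H_v)_{v\in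 V(G)}$ that induces $r$-local separations of $G$. The notions used in 3–5 are as follows. *Graph-decompositions.* A graph-decomposition $(H,(V_h)_{h\in V(H)})$ of a graph $G$ consists of a graph $H$ and vertex sets $V_h\subseteq V(G)$ (the bags) with $G=\bigcup_{h} G[V_h]$ such that, for every vertex $v$ of $G$, the subgraph $H[W_v]$ induced on $W_v=\{h : v\in V_h\}$ is (nonempty and) connected. It is into cliques if every $V_h$ is a clique of $G$. Its co-parts are connected spanning subgraphs $H_v$ of $H[W_v]$, one chosen for each vertex $v$. It is a tree-decomposition if $H$ is a tree. *Locally induced tree-decompositions.* For a vertex $v$ of $G$ let $H^{v,r}=\bigcup\{H_u : d_G(u,v)<r/2\}$ and $V^{v,r}_h=V_h\cap N^{r/2}[v]$ for each node $h$ of $H^{v,r}$. The decomposition $r$-locally induces tree-decompositions if, for every $v$, the pair $(H^{v,r},(V^{v,r}_h)_h)$ is a tree-decomposition of the ball $B_{r/2}(v)$, with the subgraphs $H_u\cap H^{v,r}$ for $u\in N^{r/2}[v]$ as co-parts. *Local separations.* For $X\subseteq V(G)$ let $\partial_G X$ be the set of edges of $G$ with exactly one end in $X$. A pre-separation $\{E_0,X,E_1\}$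 of $G$ consists of $X\subseteq V(G)$ and disjoint sets $E_0,E_1$ with $E_0\cup E_1=\partial_G X$. An $X$-walk is a walk in $G$ that starts and ends in $X$ and internally avoids $X$; it is $r$-local if it is contained in a cycle of $G$ of length at most $r$ or consists of a single edge. A pre-separation $\{E_0,X,E_1\}$ is an $r$-local separation if no $r$-local $X$-walk traverses both an edge of $E_0$ and an edge of $E_1$. A graph-decomposition with co-parts $H_v$ induces $r$-local separations of $G$ if - every $H_v$ is a tree; - for every edge $uv$ of $G$, the graph $H_u\cap H_v=H[\{h : u,v\in V_h\}]$ is connected; - for every edge $f=h_0h_1$ of $H$ with adhesion set $V_f=V_{h_0}\cap V_{h_1}$, the triple $\{E_0,V_f,E_1\}$ is an $r$-local separation of $G$, where $E_i$ is the set of all edges $vw$ of $G$ with $v\in V_f$ and $w\notin V_f$ such that $w\in V_h$ for some node $h$ of the component of $H_v-f$ containing $h_i$. -/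

import Mathlib

universe u w

namespace LocChordal

variable {V : Type u} {N : Type w}

/-! ### Balls and local chordality -/

/-- A graph is chordal if each of its cycles of length at least four has a chord. -/
def IsChordal (G : SimpleGraph V) : Prop :=
  ∀ (v : V) (c : G.Walk v v), c.IsCycle → 4 ≤ c.length →
    ∃ x ∈ c.support, ∃ y ∈ c.support, G.Adj x y ∧ s(x, y) ∉ c.edges

/-- The ball of radius `r / 2` around `v`: its vertices are the vertices at distance at most `r / 2`
from `v`, its edges are the edges of `G` whose endpoints' distances to `v` sum up to less than `r`.
Distances are extended: `edist v x = ⊤` if `x` cannot be reached from `v`. -/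
def ball (G : SimpleGraph V) (r : ℕ) (v : V) : G.Subgraph where
  verts := {x | 2 * G.edist v x ≤ r}
  Adj x y := G.Adj x y ∧ G.edist v x + G.edist v y < r
  adj_sub h := h.1
  edge_vert := by
    rintro x y ⟨hxy, hlt⟩
    have h1 : G.edist v x ≤ G.edist v y + 1 := by
      calc G.edist v x ≤ G.edist v y + G.edist y x := SimpleGraph.edist_triangle
        _ = G.edist v y + 1 := by rw [SimpleGraph.edist_eq_one_iff_adj.mpr hxy.symm]
    have hx : G.edist v x ≠ ⊤ := by
      intro h
      simp [h] at hlt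
    have hy : G.edist v y ≠ ⊤ := by
      intro h
      simp [h] at hlt
    change 2 * G.edist v x ≤ r
    generalize G.edist v x = a at *
    generalize G.edist v y = b at *
    lift a to ℕ using hx
    lift b to ℕ using hy
    norm_cast at *
    omega
  symm := ⟨by
    rintro x y ⟨hxy, hlt⟩
    exact ⟨hxy.symm, by rwa [add_comm]⟩⟩

/-- `G` is `r`-locally chordal if each of its balls of radius `r / 2` is chordal. -/
def IsLocallyChordal (G : SimpleGraph V) (r : ℕ) : Prop :=
  ∀ v : V, IsChordal (ball G r v).coe

/-! ### Region representations -/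

/-- `v ↦ K v` is a region representation of `G` over `H`: every `K v` is a region of `H`
(a nonempty connected subgraph), and distinct vertices `u`, `v` are adjacent if and only if
`K u` and `K v` have a common node. -/
structure IsRegionRepresentation (G : SimpleGraph V) (H : SimpleGraph N)
    (K : V → H.Subgraph) : Prop where
  region : ∀ v, (K v).Connected
  adj_iff : ∀ u v, u ≠ v → (G.Adj u v ↔ ((K u).verts ∩ (K v).verts).Nonempty)

/-- A family of subgraphs is `r`-acyclic if every union of at most `r` of its members is
acyclic. -/
def IsRAcyclic {H : SimpleGraph N} (r : ℕ) (K : V → H.Subgraph) : Prop :=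
  ∀ X : Set V, X.encard ≤ r → (⨆ x ∈ X, K x).coe.IsAcyclic

/-- `G` is an `r`-acyclic region intersection graph. -/
def IsRAcyclicRegionIntersectionGraph (G : SimpleGraph V) (r : ℕ) : Prop :=
  ∃ (N : Type u) (H : SimpleGraph N) (K : V → H.Subgraph),
    IsRegionRepresentation G H K ∧ IsRAcyclic r K

/-! ### Graph-decompositions -/

/-- The co-bag `W_v` of the vertex `v`: all nodes whose bag contains `v`. -/
def cobag (bag : N → Set V) (v : V) : Set N := {h | v ∈ bag h}

/-- `(H, bag)` is a graph-decomposition of `G`: the subgraphs induced on the bags have union `G`,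
and each co-bag induces a (nonempty) connected subgraph of `H`. -/
structure IsGraphDecomposition (G : SimpleGraph V) (H : SimpleGraph N)
    (bag : N → Set V) : Prop where
  union_parts : (⨆ h, (⊤ : G.Subgraph).induce (bag h)) = ⊤
  cobag_connected : ∀ v, (H.induce (cobag bag v)).Connected

/-- `K` is a valid choice of co-parts: each `K v` is a connected spanning subgraph of the
subgraph of `H` induced on the co-bag of `v`. -/
structure IsCopartFamily (H : SimpleGraph N) (bag : N → Set V)
    (K : V → H.Subgraph) : Prop where
  verts_eq : ∀ v, (K v).verts = cobag bag v
  connected : ∀ v, (K v).Connected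

/-- A graph-decomposition of `G` into cliques, together with a valid choice of co-parts. -/
structure IsGraphDecompositionIntoCliques (G : SimpleGraph V) (H : SimpleGraph N)
    (bag : N → Set V) (K : V → H.Subgraph) : Prop where
  decomp : IsGraphDecomposition G H bag
  coparts : IsCopartFamily H bag K
  cliques : ∀ h, G.IsClique (bag h)

/-! ### Locally induced decompositions -/

/-- The model graph of the decomposition which is `r`-locally induced at `v`: the union of the
co-parts of all vertices at distance less than `r / 2` from `v`. -/
def localModel (G : SimpleGraph V) {H : SimpleGraph N} (K : V → H.Subgraph) (r : ℕ) (v : V) :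
    H.Subgraph :=
  ⨆ u ∈ {u : V | 2 * G.edist v u < r}, K u

/-- The bags of the decomposition which is `r`-locally induced at `v`: the intersections of the
bags with the vertex set of the ball of radius `r / 2` around `v`. -/
def localBag (G : SimpleGraph V) {H : SimpleGraph N} (bag : N → Set V) (K : V → H.Subgraph)
    (r : ℕ) (v : V) (h : (localModel G K r v).verts) : Set (ball G r v).verts :=
  {x | (x : V) ∈ bag h}

/-- The co-parts of the decomposition which is `r`-locally induced at `v`: the co-part of a vertex
`u` of the ball is the intersection of `K u` with the local model graph (which is `K u` itself if
`u` has distance less than `r / 2` from `v`), seen as a subgraph of the local model graph. -/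
def localCopart (G : SimpleGraph V) {H : SimpleGraph N} (K : V → H.Subgraph)
    (r : ℕ) (v : V) (x : (ball G r v).verts) : (localModel G K r v).coe.Subgraph :=
  (K x).comap (localModel G K r v).hom

/-- The decompositions which are `r`-locally induced are tree-decompositions of the balls of
radius `r / 2`. -/
def LocallyInducesTreeDecompositions (G : SimpleGraph V) {H : SimpleGraph N}
    (bag : N → Set V) (K : V → H.Subgraph) (r : ℕ) : Prop :=
  ∀ v : V,
    (localModel G K r v).coe.IsTree ∧
    IsGraphDecomposition (ball G r v).coe (localModel G K r v).coe (localBag G bag K r v) ∧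
    IsCopartFamily (localModel G K r v).coe (localBag G bag K r v) (localCopart G K r v)

/-! ### Local separations -/

/-- The set of edges of `G` with exactly one end in `X`. -/
def edgeBoundary (G : SimpleGraph V) (X : Set V) : Set (Sym2 V) :=
  {e | ∃ x ∈ X, ∃ y ∉ X, G.Adj x y ∧ e = s(x, y)}

/-- `{E₀, X, E₁}` is a pre-separation of `G`: the sets `E₀` and `E₁` are disjoint, and their union
consists of the edges of `G` with exactly one end in `X`. -/
def IsPreSeparation (G : SimpleGraph V) (E₀ : Set (Sym2 V)) (X : Set V) (E₁ : Set (Sym2 V)) :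
    Prop :=
  Disjoint E₀ E₁ ∧ E₀ ∪ E₁ = edgeBoundary G X

/-- An `X`-walk starts and ends in `X` but internally avoids `X`. -/
def IsXWalk {G : SimpleGraph V} (X : Set V) {a b : V} (p : G.Walk a b) : Prop :=
  a ∈ X ∧ b ∈ X ∧ ∀ i, 0 < i → i < p.length → p.getVert i ∉ X

/-- An `r`-local `X`-walk is an `X`-walk that is contained in a cycle of length at most `r`
or that consists of a single edge (whose ends then both lie in `X`). -/
def IsLocalXWalk {G : SimpleGraph V} (r : ℕ) (X : Set V) {a b : V} (p : G.Walk a b) : Prop :=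
  IsXWalk X p ∧
    ((∃ (z : V) (c : G.Walk z z), c.IsCycle ∧ c.length ≤ r ∧ p.toSubgraph ≤ c.toSubgraph) ∨
      p.length = 1)

/-- `{E₀, X, E₁}` is an `r`-local separation of `G`: a pre-separation such that no `r`-local
`X`-walk traverses both an edge of `E₀` and an edge of `E₁`. -/
def IsLocalSeparation (G : SimpleGraph V) (r : ℕ) (E₀ : Set (Sym2 V)) (X : Set V)
    (E₁ : Set (Sym2 V)) : Prop :=
  IsPreSeparation G E₀ X E₁ ∧
    ∀ (a b : V) (p : G.Walk a b), IsLocalXWalk r X p →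
      ¬ ((∃ e ∈ p.edges, e ∈ E₀) ∧ ∃ e ∈ p.edges, e ∈ E₁)

/-- The adhesion set of an edge `h₀h₁` of the model graph. -/
def adhesion (bag : N → Set V) (h₀ h₁ : N) : Set V := bag h₀ ∩ bag h₁

/-- The nodes of the component of `K v - h₀h₁` which contains `h₀`
(for `h₀` a node of `K v`). -/
def sideNodes {H : SimpleGraph N} (K : V → H.Subgraph) (h₀ h₁ : N) (v : V) : Set N :=
  {h | ((K v).deleteEdges {s(h₀, h₁)}).spanningCoe.Reachable h₀ h}

/-- The set `E₀` of edges which the edge `h₀h₁` of `H` induces at the side of `h₀`: all edges `vw`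
of `G` with `v` in the adhesion set `X` of `h₀h₁` and `w` not in `X` such that some bag `bag h`
contains `w`, where `h` is a node of the component of `K v - h₀h₁` containing `h₀`.
The set `E₁` is obtained by exchanging `h₀` and `h₁`. -/
def sideEdges (G : SimpleGraph V) {H : SimpleGraph N} (bag : N → Set V) (K : V → H.Subgraph)
    (h₀ h₁ : N) : Set (Sym2 V) :=
  {e | ∃ v ∈ adhesion bag h₀ h₁, ∃ w ∉ adhesion bag h₀ h₁, G.Adj v w ∧ e = s(v, w) ∧
    ∃ h ∈ sideNodes K h₀ h₁ v, w ∈ bag h}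

/-- The decomposition induces `r`-local separations of `G`: each co-part is a tree, the co-parts
of adjacent vertices `u`, `v` intersect in the subgraph of `H` induced on the nodes whose bags
contain both `u` and `v` and this intersection is connected, and every edge of the model graph
induces an `r`-local separation. -/
structure InducesLocalSeparations (G : SimpleGraph V) (H : SimpleGraph N)
    (bag : N → Set V) (K : V → H.Subgraph) (r : ℕ) : Prop where
  copart_isTree : ∀ v, (K v).coe.IsTree
  inter_eq : ∀ u v, G.Adj u v →
    K u ⊓ K v = (⊤ : H.Subgraph).induce {h | u ∈ bag h ∧ v ∈ bag h}
  inter_connected : ∀ u v, G.Adj u v → (K u ⊓ K v).Connected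
  edge_induces : ∀ h₀ h₁, H.Adj h₀ h₁ →
    IsLocalSeparation G r (sideEdges G bag K h₀ h₁) (adhesion bag h₀ h₁)
      (sideEdges G bag K h₁ h₀)

end LocChordal

/-!
Throughout, acyclicity is certified by cut functions modulo two: a subgraph of the model graph `H`
is acyclic if and only if for each `e` there is a function on the nodes that changes along an edge
of the subgraph exactly if this edge is `e` (`isAcyclic_coe_iff`). Suppose that each co-part `K v`
has such a function `s v`, and that the co-parts of adjacent vertices of `G` have connected
intersections. Then `s u` and `s v` differ on `K u ∩ K v` by a constant `φ u v`, so `φ` is a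
function on the edges of `G`. If `φ` sums up to zero along the cycles within a vertex set `Z`, it
has a potential there, and shifting the `s v` accordingly glues them to a cut function of `⋃_{v ∈ Z}
K v` (`exists_potential`, `exists_isCut_of_potential`). This turns questions about `H` into
questions about cycles of `G`.

* From local chordality to a decomposition (`exists_induced_decomposition`): the nodes are the
  maximal cliques. For each set `X`, the maximal cliques containing `X`, grouped by the components
  of the relation of intersecting in more than `X`, are joined by a star between representatives of
  these components. By downward induction on a nonempty clique `X`, the maximal cliques containing
  `X` induce a tree: the function `φ` on the common neighbours of `X` vanishes on triangles, because
  of the maximal cliques containing them, and hence on all cycles, because links are chordal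
  (`IsChordal.walkSum_eq_zero`). Since at most `r` vertices induce a chordal graph, too, the same
  argument shows that the decomposition is `r`-acyclic.
* From `r`-acyclicity to local tree-decompositions: `φ` sums up to zero along closed walks of length
  at most `r`. Thus the sums along shortest walks from `v` are a potential on the ball around `v`,
  no matter how many vertices it has (`IsRegionRepresentation.isAcyclic_biSup`).
* From local tree-decompositions to local chordality: subtrees of a tree do not form a chordless
  cycle, by the Helly property (`exists_inter_nonempty_of_chordless`). Vertices at distance exactly
  `r / 2` from the centre need an extra argument, since the ball omits the edges between them
  (`inter_nonempty_of_adj_boundary`).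
* Local separations: for an edge `h₀h₁` of `H`, `φ` is the indicator function of the side `E₁` of
  the separation it induces. As this separation is `r`-local, cycles of length at most `r` traverse
  an even number of edges in `E₁`, so `φ` vanishes on them (`InducesLocalSeparations.isRAcyclic`).
  Conversely, in an `r`-acyclic decomposition, `h₀h₁` is a bridge of the union of the co-parts along
  such a cycle (`IsGraphDecompositionIntoCliques.inducesLocalSeparations`).
-/

namespace LocChordal

variable {V : Type u} {N : Type w}

/-! ### Cut functions and acyclicity -/

section Cuts

variable {H : SimpleGraph N}

open Classical in
/-- `q` is a cut function of the subgraph `K` for `e`: along an edge of `K`, the value of `q`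
changes if and only if this edge is `e`. If `e` is an edge of `K`, such a `q` certifies that `e` is
a bridge of `K`; the sets `{q = 0}` and `{q = 1}` are the sides of the corresponding cut. -/
def IsCut (K : H.Subgraph) (e : Sym2 N) (q : N → ZMod 2) : Prop :=
  ∀ a b, K.Adj a b → q a + q b = if s(a, b) = e then 1 else 0

lemma zmod_two_add_self (a : ZMod 2) : a + a = 0 := CharTwo.add_self_eq_zero a

lemma zmod_two_eq_of_add_eq_zero {a b : ZMod 2} (h : a + b = 0) : a = b := by
  revert a b; decide

lemma IsCut.mono {K L : H.Subgraph} {e : Sym2 N} {q : N → ZMod 2} (h : IsCut L e q) (hKL : K ≤ L) :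
    IsCut K e q := fun a b hab => h a b (hKL.2 hab)

lemma IsCut.eq_of_reachable {K : H.Subgraph} {e : Sym2 N} {q : N → ZMod 2} (h : IsCut K e q)
    {T : SimpleGraph N} (hT : ∀ a b, T.Adj a b → K.Adj a b ∧ s(a, b) ≠ e) {a b : N}
    (hab : T.Reachable a b) : q a = q b := by
  obtain ⟨p⟩ := hab
  induction p with
  | nil => rfl
  | cons hadj p ih =>
    obtain ⟨h1, h2⟩ := hT _ _ hadj
    have := h _ _ h1
    rw [if_neg h2] at this
    rw [zmod_two_eq_of_add_eq_zero this, ih]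

/-- Two cut functions of a connected subgraph for the same `e` differ by a constant. -/
lemma IsCut.add_eq_add {K : H.Subgraph} {e : Sym2 N} {q q' : N → ZMod 2} (h : IsCut K e q)
    (h' : IsCut K e q') {a b : N} (hab : K.spanningCoe.Reachable a b) :
    q a + q' a = q b + q' b := by
  obtain ⟨p⟩ := hab
  induction p with
  | nil => rfl
  | @cons u v _ hadj p ih =>
    have h1 := (h _ _ hadj).trans (h' _ _ hadj).symm
    rw [← ih]
    generalize q u = x1, q v = x2, q' u = x3, q' v = x4 at h1
    revert x1 x2 x3 x4; decide

/-- A subgraph is acyclic if and only if all edges have cut functions. -/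
lemma isAcyclic_coe_iff {K : H.Subgraph} : K.coe.IsAcyclic ↔ ∀ e, ∃ q, IsCut K e q := by
  classical
  constructor
  · intro hK e
    by_cases he : e ∈ K.edgeSet
    · induction e with | _ a b =>
      have hab : K.Adj a b := he
      let a' : K.verts := ⟨a, K.edge_vert hab⟩
      let b' : K.verts := ⟨b, K.edge_vert hab.symm⟩
      have hbr := SimpleGraph.isAcyclic_iff_forall_adj_isBridge.mp hK (v := a') (w := b') hab
      rw [SimpleGraph.isBridge_iff] at hbr
      refine ⟨fun h => if hh : h ∈ K.verts then
        if (K.coe.deleteEdges {s(a', b')}).Reachable a' ⟨h, hh⟩ then 0 else 1 else 0, ?_⟩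
      intro x y hxy
      have hx := K.edge_vert hxy
      have hy := K.edge_vert hxy.symm
      simp only [hx, hy, dif_pos]
      have hself : (K.coe.deleteEdges {s(a', b')}).Reachable a' a' := .rfl
      by_cases hxe : s(x, y) = s(a, b)
      · rw [if_pos hxe]
        rcases Sym2.eq_iff.mp hxe with ⟨rfl, rfl⟩ | ⟨rfl, rfl⟩
        · rw [if_pos hself, if_neg hbr]; rfl
        · rw [if_pos hself, if_neg hbr]; rfl
      · rw [if_neg hxe]
        have hadj : (K.coe.deleteEdges {s(a', b')}).Adj ⟨x, hx⟩ ⟨y, hy⟩ := by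
          rw [SimpleGraph.deleteEdges_adj]
          refine ⟨hxy, fun h => hxe ?_⟩
          have := congrArg (Sym2.map Subtype.val) h
          simpa using this
        have : (K.coe.deleteEdges {s(a', b')}).Reachable a' ⟨x, hx⟩ ↔
            (K.coe.deleteEdges {s(a', b')}).Reachable a' ⟨y, hy⟩ :=
          ⟨fun h => h.trans hadj.reachable, fun h => h.trans hadj.symm.reachable⟩
        simp only [this]
        exact zmod_two_add_self _
    · refine ⟨0, fun a b hab => ?_⟩
      rw [if_neg (by rintro rfl; exact he hab)]; simp
  · intro h
    rw [SimpleGraph.isAcyclic_iff_forall_adj_isBridge]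
    rintro ⟨a, ha⟩ ⟨b, hb⟩ hab
    rw [SimpleGraph.isBridge_iff]
    intro hr
    obtain ⟨q, hq⟩ := h s(a, b)
    have h1 := hq a b hab
    rw [if_pos rfl] at h1
    have key : ∀ x y : K.verts, (K.coe.deleteEdges {s(⟨a, ha⟩, ⟨b, hb⟩)}).Reachable x y →
        q x = q y := by
      rintro x y ⟨p⟩
      induction p with
      | nil => rfl
      | @cons u v _ hadj p ih =>
        rw [SimpleGraph.deleteEdges_adj] at hadj
        have h2 := hq u v hadj.1
        rw [if_neg] at h2
        · rw [zmod_two_eq_of_add_eq_zero h2, ih]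
        · intro he
          apply hadj.2
          rw [Set.mem_singleton_iff]
          apply Sym2.map.injective Subtype.val_injective
          simpa using he
    have := key _ _ hr
    simp only at this
    rw [this, zmod_two_add_self] at h1
    exact zero_ne_one h1

/-- A union of subgraphs is acyclic if and only if all edges have common cut functions. -/
lemma isAcyclic_biSup_coe_iff {K : V → H.Subgraph} {Z : Set V} :
    (⨆ x ∈ Z, K x).coe.IsAcyclic ↔ ∀ e, ∃ q, ∀ x ∈ Z, IsCut (K x) e q := by
  rw [isAcyclic_coe_iff]
  refine forall_congr' fun e => exists_congr fun q => ?_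
  simp only [IsCut, SimpleGraph.Subgraph.iSup_adj]
  constructor
  · intro h x hx a b hab
    exact h a b ⟨x, hx, hab⟩
  · rintro h a b ⟨x, hx, hab⟩
    exact h x hx a b hab

/-- Cut functions of the members of a family which agree after shifts by constants can be glued. -/
lemma exists_isCut_of_potential {K : V → H.Subgraph} {Z : Set V} {e : Sym2 N}
    (s : V → N → ZMod 2) (hs : ∀ i ∈ Z, IsCut (K i) e (s i)) (p : V → ZMod 2)
    (hp : ∀ i ∈ Z, ∀ j ∈ Z, i ≠ j → ∀ h ∈ (K i).verts, h ∈ (K j).verts →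
      s i h + s j h = p i + p j) :
    ∃ q, ∀ i ∈ Z, IsCut (K i) e q := by
  classical
  let q : N → ZMod 2 := fun h =>
    if hh : ∃ i ∈ Z, h ∈ (K i).verts then s hh.choose h + p hh.choose else 0
  have hq : ∀ i ∈ Z, ∀ h ∈ (K i).verts, q h = s i h + p i := by
    intro i hi h hh
    have hex : ∃ i ∈ Z, h ∈ (K i).verts := ⟨i, hi, hh⟩
    simp only [q, dif_pos hex]
    obtain ⟨h1, h2⟩ := hex.choose_spec
    by_cases heq : i = hex.choose
    · rw [← heq]
    · have := hp i hi _ h1 heq h hh h2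
      generalize s i h = x1, s hex.choose h = x2, p i = x3, p hex.choose = x4 at *
      revert x1 x2 x3 x4; decide
  refine ⟨q, fun i hi a b hab => ?_⟩
  rw [hq i hi a ((K i).edge_vert hab), hq i hi b ((K i).edge_vert hab.symm), ← hs i hi a b hab]
  generalize s i a = x1, s i b = x2, p i = x3
  revert x1 x2 x3; decide

end Cuts

/-! ### Connected subgraphs of forests -/

section Connected

variable {H : SimpleGraph N}

lemma reachable_coe_iff {K : H.Subgraph} {a b : N} (ha : a ∈ K.verts) (hb : b ∈ K.verts) :
    K.coe.Reachable ⟨a, ha⟩ ⟨b, hb⟩ ↔ K.spanningCoe.Reachable a b := by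
  constructor
  · intro h
    exact h.map K.coeEmbeddingSpanningCoe.toHom
  · rintro ⟨p⟩
    induction p with
    | nil => rfl
    | @cons u v _ hadj p ih =>
      have hv : v ∈ K.verts := K.edge_vert (SimpleGraph.Subgraph.Adj.symm hadj)
      have h1 : K.coe.Adj ⟨u, ha⟩ ⟨v, hv⟩ := hadj
      exact h1.reachable.trans (ih hv hb)

lemma preconnected_iff_reachable {K : H.Subgraph} :
    K.Preconnected ↔ ∀ a ∈ K.verts, ∀ b ∈ K.verts, K.spanningCoe.Reachable a b := by
  rw [SimpleGraph.Subgraph.preconnected_iff]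
  constructor
  · intro h a ha b hb
    exact (reachable_coe_iff ha hb).mp (h _ _)
  · rintro h ⟨a, ha⟩ ⟨b, hb⟩
    exact (reachable_coe_iff ha hb).mpr (h a ha b hb)

lemma connected_iff_reachable {K : H.Subgraph} :
    K.Connected ↔ K.verts.Nonempty ∧
      ∀ a ∈ K.verts, ∀ b ∈ K.verts, K.spanningCoe.Reachable a b := by
  rw [SimpleGraph.Subgraph.connected_iff, preconnected_iff_reachable, and_comm]

lemma reachable_of_connected {K : H.Subgraph} (hK : K.Connected) {a b : N} (ha : a ∈ K.verts)
    (hb : b ∈ K.verts) : K.spanningCoe.Reachable a b :=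
  (connected_iff_reachable.mp hK).2 a ha b hb

lemma reachable_mono {K L : H.Subgraph} (hKL : K ≤ L) {a b : N}
    (h : K.spanningCoe.Reachable a b) : L.spanningCoe.Reachable a b :=
  h.mono (SimpleGraph.Subgraph.spanningCoe_le_of_le hKL)

lemma isAcyclic_spanningCoe {K : H.Subgraph} (hK : K.coe.IsAcyclic) :
    K.spanningCoe.IsAcyclic := by
  rw [SimpleGraph.isAcyclic_iff_forall_adj_isBridge]
  intro a b hab
  obtain ⟨q, hq⟩ := isAcyclic_coe_iff.mp hK s(a, b)
  rw [SimpleGraph.isBridge_iff]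
  intro hr
  have h1 := hq a b hab
  rw [if_pos rfl, hq.eq_of_reachable (fun x y hxy => ?_) hr, zmod_two_add_self] at h1
  · exact zero_ne_one h1
  · rw [SimpleGraph.deleteEdges_adj] at hxy
    exact hxy

/-- Two connected subgraphs with acyclic union have a connected intersection, provided that they
meet: a path of the union is determined by its ends. -/
lemma connected_inf {A B : H.Subgraph} (hA : A.Connected) (hB : B.Connected)
    (hAB : (A ⊔ B).coe.IsAcyclic) (hne : (A.verts ∩ B.verts).Nonempty) : (A ⊓ B).Connected := by
  classical
  rw [connected_iff_reachable]
  refine ⟨hne, ?_⟩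
  rintro a ⟨haA, haB⟩ b ⟨hbA, hbB⟩
  obtain ⟨p, hp⟩ := (reachable_of_connected hA haA hbA).exists_isPath
  obtain ⟨p', hp'⟩ := (reachable_of_connected hB haB hbB).exists_isPath
  have hleA : A.spanningCoe ≤ (A ⊔ B).spanningCoe :=
    SimpleGraph.Subgraph.spanningCoe_le_of_le le_sup_left
  have hleB : B.spanningCoe ≤ (A ⊔ B).spanningCoe :=
    SimpleGraph.Subgraph.spanningCoe_le_of_le le_sup_right
  have huniq := ((isAcyclic_spanningCoe hAB).subsingleton_path _ _).elim
    ⟨p.mapLe hleA, hp.mapLe hleA⟩ ⟨p'.mapLe hleB, hp'.mapLe hleB⟩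
  have hedges : p.edges = p'.edges := by
    have := congrArg (fun P => P.1.edges) huniq
    simpa only [SimpleGraph.Walk.edges_mapLe_eq_edges] using this
  refine ⟨p.transfer _ ?_⟩
  intro e he
  have h1 := p.edges_subset_edgeSet he
  have h2 := p'.edges_subset_edgeSet (hedges ▸ he)
  induction e with | _ x y => exact ⟨h1, h2⟩

/-- If a walk of `A ⊔ B` runs from `A` to `B`, one of its vertices lies in both. -/
lemma exists_mem_support_inter {A B : H.Subgraph} {a b : N} (p : (A ⊔ B).spanningCoe.Walk a b)
    (ha : a ∈ A.verts) (hb : b ∈ B.verts) : ∃ c ∈ p.support, c ∈ A.verts ∧ c ∈ B.verts := by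
  induction p with
  | nil => exact ⟨_, by simp, ha, hb⟩
  | @cons u v w hadj p ih =>
    by_cases hv : v ∈ A.verts
    · obtain ⟨c, hc, h⟩ := ih hv hb
      exact ⟨c, List.mem_cons_of_mem _ hc, h⟩
    · refine ⟨u, by simp, ha, ?_⟩
      rcases hadj with h | h
      · exact absurd (A.edge_vert h.symm) hv
      · exact B.edge_vert h

lemma mem_verts_of_mem_support {A : H.Subgraph} {a b : N} (p : A.spanningCoe.Walk a b)
    (ha : a ∈ A.verts) {c : N} (hc : c ∈ p.support) : c ∈ A.verts := by
  induction p with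
  | nil => simp at hc; exact hc ▸ ha
  | @cons u v w hadj p ih =>
    rw [SimpleGraph.Walk.support_cons, List.mem_cons] at hc
    rcases hc with rfl | hc
    · exact ha
    · exact ih (A.edge_vert (SimpleGraph.Subgraph.Adj.symm hadj)) hc

/-- The Helly property of subtrees, for three subtrees. -/
lemma helly_three {A B C : H.Subgraph} (hH : H.IsAcyclic) (hA : A.Connected) (hB : B.Connected)
    (hC : C.Connected) (hAB : (A.verts ∩ B.verts).Nonempty) (hAC : (A.verts ∩ C.verts).Nonempty)
    (hBC : (B.verts ∩ C.verts).Nonempty) : ∃ c ∈ A.verts, c ∈ B.verts ∧ c ∈ C.verts := by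
  classical
  obtain ⟨x, hxA, hxC⟩ := hAC
  obtain ⟨y, hyB, hyC⟩ := hBC
  have hconn : (A ⊔ B).Connected := SimpleGraph.Subgraph.connected_sup hA.preconnected
    hB.preconnected hAB
  obtain ⟨p, hp⟩ := (reachable_of_connected hC hxC hyC).exists_isPath
  obtain ⟨p', hp'⟩ := (reachable_of_connected hconn (Or.inl hxA) (Or.inr hyB)).exists_isPath
  have huniq := (hH.subsingleton_path _ _).elim ⟨p.mapLe C.spanningCoe_le, hp.mapLe _⟩
    ⟨p'.mapLe (A ⊔ B).spanningCoe_le, hp'.mapLe _⟩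
  have hsupp : p.support = p'.support := by
    have := congrArg (fun P => P.1.support) huniq
    simpa only [SimpleGraph.Walk.support_mapLe_eq_support] using this
  obtain ⟨c, hc, hcA, hcB⟩ := exists_mem_support_inter p' hxA hyB
  exact ⟨c, hcA, hcB, mem_verts_of_mem_support p hxC (hsupp ▸ hc)⟩

/-- Subtrees of a forest cannot form a cycle of length four without chords. -/
lemma not_four_cycle {A B C D : H.Subgraph} (hH : H.IsAcyclic) (hA : A.Connected)
    (hB : B.Connected) (hC : C.Connected) (hD : D.Connected)
    (hAC : (A.verts ∩ C.verts).Nonempty) (hCB : (C.verts ∩ B.verts).Nonempty)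
    (hBD : (B.verts ∩ D.verts).Nonempty) (hDA : (D.verts ∩ A.verts).Nonempty) :
    (A.verts ∩ B.verts).Nonempty ∨ (C.verts ∩ D.verts).Nonempty := by
  have hconn : (A ⊔ C).Connected := SimpleGraph.Subgraph.connected_sup hA.preconnected
    hC.preconnected hAC
  obtain ⟨c, hc, hcD, hcB⟩ := helly_three hH hconn hD hB
    (hDA.mono fun x hx => ⟨Or.inl hx.2, hx.1⟩) (hCB.mono fun x hx => ⟨Or.inr hx.1, hx.2⟩)
    (hBD.mono fun x hx => ⟨hx.2, hx.1⟩)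
  rcases hc with hc | hc
  · exact Or.inl ⟨c, hc, hcB⟩
  · exact Or.inr ⟨c, hc, hcD⟩

end Connected

/-! ### Cocycles modulo two -/

section Cocycles

variable {G : SimpleGraph V}

/-- The sum of the values of `φ` along a walk, modulo two. -/
def walkSum (φ : V → V → ZMod 2) {a b : V} (p : G.Walk a b) : ZMod 2 :=
  (p.darts.map fun d => φ d.fst d.snd).sum

@[simp] lemma walkSum_nil (φ : V → V → ZMod 2) (a : V) :
    walkSum φ (SimpleGraph.Walk.nil : G.Walk a a) = 0 := rfl

@[simp] lemma walkSum_cons (φ : V → V → ZMod 2) {a b c : V} (h : G.Adj a b) (p : G.Walk b c) :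
    walkSum φ (p.cons h) = φ a b + walkSum φ p := by
  simp [walkSum]

@[simp] lemma walkSum_append (φ : V → V → ZMod 2) {a b c : V} (p : G.Walk a b) (q : G.Walk b c) :
    walkSum φ (p.append q) = walkSum φ p + walkSum φ q := by
  simp [walkSum]

lemma walkSum_reverse {φ : V → V → ZMod 2} (hφ : ∀ a b, G.Adj a b → φ a b = φ b a) {a b : V}
    (p : G.Walk a b) : walkSum φ p.reverse = walkSum φ p := by
  induction p with
  | nil => rfl
  | cons h p ih =>
    rw [SimpleGraph.Walk.reverse_cons, walkSum_append, walkSum_cons, walkSum_cons, ih, walkSum_nil,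
      hφ _ _ h]
    ring

lemma walkSum_rotate [DecidableEq V] (φ : V → V → ZMod 2) {a b : V} (c : G.Walk a a)
    (h : b ∈ c.support) : walkSum φ (c.rotate b h) = walkSum φ c := by
  conv_rhs => rw [← c.take_spec h]
  rw [SimpleGraph.Walk.rotate, walkSum_append, walkSum_append, add_comm]

/-- Along a walk, the sum of the coboundary of `p` telescopes. -/
lemma walkSum_of_potential {φ : V → V → ZMod 2} {p : V → ZMod 2} {a b : V} (w : G.Walk a b)
    (h : ∀ x ∈ w.support, ∀ y ∈ w.support, G.Adj x y → φ x y = p x + p y) :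
    walkSum φ w = p a + p b := by
  induction w with
  | nil => rw [walkSum_nil, zmod_two_add_self]
  | @cons u v _ hadj w ih =>
    rw [walkSum_cons, ih (fun x hx y hy => h x (List.mem_cons_of_mem _ hx) y
      (List.mem_cons_of_mem _ hy)), h u (by simp) v (by simp) hadj]
    grind

/-- If the sum along all cycles that are at most as long as a given walk is zero, then the sum does
not change when the walk is shortened to a path. -/
lemma walkSum_bypass [DecidableEq V] {φ : V → V → ZMod 2}
    (hφ : ∀ a b, G.Adj a b → φ a b = φ b a) {a b : V} (w : G.Walk a b)
    (hc : ∀ (v : V) (c : G.Walk v v), c.IsCycle → c.length ≤ w.length → walkSum φ c = 0) :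
    walkSum φ w.bypass = walkSum φ w := by
  induction w with
  | nil => rfl
  | @cons u v z hadj w ih =>
    have ih' := ih fun v c h1 h2 => hc v c h1 (by rw [SimpleGraph.Walk.length_cons]; omega)
    rw [SimpleGraph.Walk.bypass]
    split_ifs with hs
    · rw [walkSum_cons, ← ih']
      conv_rhs => rw [← w.bypass.take_spec hs]
      rw [walkSum_append]
      set t := w.bypass.takeUntil u hs with ht
      have htp : t.IsPath := (w.bypass_isPath).takeUntil hs
      have hlen : t.length ≤ w.length :=
        (w.bypass.length_takeUntil_le_length hs).trans w.length_bypass_le_length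
      -- the closed walk which is cut off is a cycle, unless it traverses one edge twice
      have hsum : φ u v + walkSum φ t = 0 := by
        by_cases he : s(u, v) ∈ t.edges
        · clear_value t
          cases t with
          | nil => exact absurd hadj (G.irrefl)
          | @cons _ v' _ hadj' t =>
            rw [SimpleGraph.Walk.cons_isPath_iff] at htp
            rw [SimpleGraph.Walk.edges_cons, List.mem_cons] at he
            rcases he with he | he
            · have : v' = u := by
                rcases Sym2.eq_iff.mp he with ⟨h1, h2⟩ | ⟨h1, h2⟩
                · exact absurd h1 hadj.ne
                · exact h1.symm
              subst this
              rw [(SimpleGraph.Walk.isPath_iff_nil.mp htp.1).eq_nil, walkSum_cons,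
                walkSum_nil, hφ _ _ hadj, add_zero, zmod_two_add_self]
            · exact absurd (t.snd_mem_support_of_mem_edges he) htp.2
        · rw [← walkSum_cons φ hadj]
          refine hc _ _ ((SimpleGraph.Walk.cons_isCycle_iff _ _).mpr ⟨htp, he⟩) ?_
          simp only [SimpleGraph.Walk.length_cons]
          omega
      rw [← add_assoc, hsum, zero_add]
    · rw [walkSum_cons, walkSum_cons, ih']

lemma walkSum_closed_eq_zero {φ : V → V → ZMod 2}
    (hφ : ∀ a b, G.Adj a b → φ a b = φ b a) {a : V} (w : G.Walk a a)
    (hc : ∀ (v : V) (c : G.Walk v v), c.IsCycle → c.length ≤ w.length → walkSum φ c = 0) :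
    walkSum φ w = 0 := by
  classical
  rw [← walkSum_bypass hφ w hc, (SimpleGraph.Walk.isPath_iff_nil.mp w.bypass_isPath).eq_nil,
    walkSum_nil]

/-- A cocycle modulo two that vanishes on all cycles is a coboundary. -/
lemma exists_potential {φ : V → V → ZMod 2} (hφ : ∀ a b, G.Adj a b → φ a b = φ b a)
    (hc : ∀ (v : V) (c : G.Walk v v), c.IsCycle → walkSum φ c = 0) :
    ∃ p : V → ZMod 2, ∀ a b, G.Adj a b → φ a b = p a + p b := by
  have hr : ∀ v, G.Reachable (G.connectedComponentMk v).out v := fun v =>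
    SimpleGraph.ConnectedComponent.exact (Quot.out_eq _)
  refine ⟨fun v => walkSum φ (hr v).some, fun a b hab => ?_⟩
  have heq : (G.connectedComponentMk a).out = (G.connectedComponentMk b).out := by
    rw [SimpleGraph.ConnectedComponent.sound hab.reachable]
  have := walkSum_closed_eq_zero hφ ((hr a).some.append ((hr b).some.reverse.cons hab |>.copy rfl
    heq.symm)) fun v c h _ => hc v c h
  have hcopy : ∀ {x y y' : V} (h : y = y') (w : G.Walk x y),
      walkSum φ (w.copy rfl h) = walkSum φ w := by
    rintro x y _ rfl w; rfl
  rw [walkSum_append, hcopy, walkSum_cons, walkSum_reverse hφ] at this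
  grind

/-- In a chordal graph, a symmetric function on the edges that sums up to zero on all triangles
sums up to zero on all cycles: a chord splits a cycle into two shorter closed walks. -/
lemma IsChordal.walkSum_eq_zero (hG : IsChordal G) {φ : V → V → ZMod 2}
    (hφ : ∀ a b, G.Adj a b → φ a b = φ b a)
    (ht : ∀ a b c, G.Adj a b → G.Adj b c → G.Adj c a → φ a b + φ b c + φ c a = 0)
    (v : V) (c : G.Walk v v) (hc : c.IsCycle) : walkSum φ c = 0 := by
  classical
  induction hn : c.length using Nat.strong_induction_on generalizing v c with
  | _ n ih =>
  subst hn
  rcases hc.three_le_length.eq_or_lt with h3 | h4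
  · cases c with
    | nil => simp at h3
    | cons h1 c =>
      cases c with
      | nil => simp at h3
      | cons h2 c =>
        cases c with
        | nil => simp at h3
        | cons h3' c =>
          cases c with
          | nil =>
            rw [walkSum_cons, walkSum_cons, walkSum_cons, walkSum_nil, add_zero, ← add_assoc,
              ht _ _ _ h1 h2 h3']
          | cons h4 c => simp at h3
  · obtain ⟨x, hx, y, hy, hxy, hne⟩ := hG v c hc h4
    have hlen : (c.rotate x hx).length = c.length := SimpleGraph.Walk.length_rotate ..
    have hy' : y ∈ (c.rotate x hx).support := by
      rw [SimpleGraph.Walk.mem_support_rotate_iff]; exact hy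
    have hne' : s(x, y) ∉ (c.rotate x hx).edges := by
      rwa [(SimpleGraph.Walk.rotate_edges c x hx).mem_iff]
    rw [← walkSum_rotate φ c hx]
    have hcr := hc.rotate hx
    generalize c.rotate x hx = c' at *
    have hspec := c'.take_spec hy'
    set p := c'.takeUntil y hy'
    set q := c'.dropUntil y hy'
    clear_value p q
    subst hspec
    rw [SimpleGraph.Walk.length_append] at hlen
    rw [SimpleGraph.Walk.edges_append, List.mem_append, not_or] at hne'
    have hp2 : 2 ≤ p.length := by
      rcases p with _ | ⟨h, _ | ⟨h', p⟩⟩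
      · exact absurd hxy G.irrefl
      · simp at hne'
      · simp
    have hq2 : 2 ≤ q.length := by
      rcases q with _ | ⟨h, _ | ⟨h', q⟩⟩
      · exact absurd hxy G.irrefl
      · simp [Sym2.eq_swap] at hne'
      · simp
    have h1 := walkSum_closed_eq_zero hφ (p.cons hxy.symm) fun v d hd hd' =>
      ih _ (by rw [SimpleGraph.Walk.length_cons] at hd'; omega) v d hd rfl
    have h2 := walkSum_closed_eq_zero hφ (q.cons hxy) fun v d hd hd' =>
      ih _ (by rw [SimpleGraph.Walk.length_cons] at hd'; omega) v d hd rfl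
    rw [walkSum_cons] at h1 h2
    rw [walkSum_append]
    rw [hφ _ _ hxy] at h2
    grind

end Cocycles

/-! ### Short cycles and links of locally chordal graphs -/

section Local

variable {G : SimpleGraph V}

lemma exists_isCycle_coe {K : G.Subgraph} {a : V} (c : G.Walk a a) (hc : c.IsCycle)
    (hK : c.toSubgraph ≤ K) :
    ∃ (a' : K.verts) (c' : K.coe.Walk a' a'), c'.IsCycle ∧ c'.length = c.length ∧
      c'.support.map (↑) = c.support ∧ c'.edges.map (Sym2.map (↑)) = c.edges := by
  let c' := c.mapToSubgraph.map (SimpleGraph.Subgraph.inclusion hK)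
  have h : c'.map K.hom = c := by
    rw [SimpleGraph.Walk.map_map]
    exact c.map_mapToSubgraph_hom
  refine ⟨_, c', ?_, ?_, ?_, ?_⟩
  · refine SimpleGraph.Walk.IsCycle.of_map (f := K.hom) ?_
    rw [h]; exact hc
  · conv_rhs => rw [← h]
    exact (SimpleGraph.Walk.length_map _ _).symm
  · exact (SimpleGraph.Walk.support_map K.hom c').symm.trans (congrArg _ h)
  · exact (SimpleGraph.Walk.edges_map K.hom c').symm.trans (congrArg _ h)

/-- Cycles inside a ball of a locally chordal graph have chords. -/
lemma IsLocallyChordal.exists_chord {r : ℕ} (hG : IsLocallyChordal G r) (z : V) {v : V}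
    {c : G.Walk v v} (hc : c.IsCycle) (h4 : 4 ≤ c.length)
    (hz : ∀ x y, s(x, y) ∈ c.edges → G.edist z x + G.edist z y < r) :
    ∃ x ∈ c.support, ∃ y ∈ c.support, G.Adj x y ∧ s(x, y) ∉ c.edges := by
  have hle : c.toSubgraph ≤ ball G r z := by
    rw [SimpleGraph.Walk.toSubgraph_le_iff hc.not_nil]
    intro e he
    induction e with | _ x y =>
    exact ⟨c.adj_of_mem_edges (by simpa using he), hz x y (by simpa using he)⟩
  obtain ⟨a, c', hc', hlen, hsupp, hedges⟩ := exists_isCycle_coe c hc hle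
  obtain ⟨x, hx, y, hy, hxy, hne⟩ := hG z a c' hc' (hlen ▸ h4)
  rw [← hsupp, ← hedges]
  refine ⟨x, List.mem_map_of_mem hx, y, List.mem_map_of_mem hy, hxy.1, fun he => hne ?_⟩
  obtain ⟨e, he, heq⟩ := List.mem_map.mp he
  rwa [← Sym2.map.injective Subtype.val_injective (a₂ := s(x, y)) (by simpa using heq)]

lemma edist_getVert_le {a b : V} (c : G.Walk a b) (i : ℕ) : G.edist a (c.getVert i) ≤ i := by
  refine (SimpleGraph.edist_le (c.take i)).trans ?_
  rw [SimpleGraph.Walk.take_length]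
  exact_mod_cast min_le_left _ _

lemma edist_getVert_le_sub {a b : V} (c : G.Walk a b) (i : ℕ) :
    G.edist b (c.getVert i) ≤ (c.length - i : ℕ) := by
  rw [SimpleGraph.edist_comm]
  refine (SimpleGraph.edist_le (c.drop i)).trans ?_
  rw [SimpleGraph.Walk.drop_length]

lemma IsLocallyChordal.exists_chord_of_length_le {r : ℕ} (hG : IsLocallyChordal G r) {v : V}
    {c : G.Walk v v} (hc : c.IsCycle) (h4 : 4 ≤ c.length) (hr : c.length ≤ r) :
    ∃ x ∈ c.support, ∃ y ∈ c.support, G.Adj x y ∧ s(x, y) ∉ c.edges := by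
  refine hG.exists_chord v hc h4 fun x y hxy => ?_
  rw [SimpleGraph.Walk.mk_mem_edges_iff_exists] at hxy
  obtain ⟨i, hi, heq⟩ := hxy
  have h1 := edist_getVert_le c i
  have h2 := edist_getVert_le_sub c (i + 1)
  have h3 : G.edist v (c.getVert i) + G.edist v (c.getVert (i + 1)) < r := by
    refine (add_le_add h1 h2).trans_lt ?_
    norm_cast
    omega
  rcases Sym2.eq_iff.mp heq with ⟨rfl, rfl⟩ | ⟨rfl, rfl⟩
  · exact h3
  · rwa [add_comm]

lemma isChordal_induce {Z : Set V}
    (h : ∀ (v : V) (c : G.Walk v v), c.IsCycle → 4 ≤ c.length → (∀ x ∈ c.support, x ∈ Z) →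
      ∃ x ∈ c.support, ∃ y ∈ c.support, G.Adj x y ∧ s(x, y) ∉ c.edges) :
    IsChordal (G.induce Z) := by
  intro v c hc h4
  let f := (SimpleGraph.Embedding.induce (G := G) Z).toHom
  have hf : Function.Injective f := Subtype.val_injective
  obtain ⟨x, hx, y, hy, hxy, hne⟩ := h _ (c.map f) (hc.map hf) (by simpa using h4) (by
    intro x hx
    rw [SimpleGraph.Walk.support_map, List.mem_map] at hx
    obtain ⟨y, _, rfl⟩ := hx
    exact y.2)
  rw [SimpleGraph.Walk.support_map, List.mem_map] at hx hy
  obtain ⟨x, hx, rfl⟩ := hx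
  obtain ⟨y, hy, rfl⟩ := hy
  refine ⟨x, hx, y, hy, hxy, fun he => hne ?_⟩
  rw [SimpleGraph.Walk.edges_map, List.mem_map]
  exact ⟨_, he, rfl⟩

/-- The link of a vertex in a locally chordal graph is chordal, as is each of its subsets. -/
lemma IsLocallyChordal.isChordal_link {r : ℕ} (hr : 3 ≤ r) (hG : IsLocallyChordal G r) {z : V}
    {Z : Set V} (hZ : ∀ x ∈ Z, G.Adj z x) : IsChordal (G.induce Z) := by
  refine isChordal_induce fun v c hc h4 hsupp => hG.exists_chord z hc h4 fun x y hxy => ?_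
  rw [SimpleGraph.edist_eq_one_iff_adj.mpr (hZ x (hsupp x (c.fst_mem_support_of_mem_edges hxy))),
    SimpleGraph.edist_eq_one_iff_adj.mpr (hZ y (hsupp y (c.snd_mem_support_of_mem_edges hxy)))]
  norm_cast

/-- All vertices of a closed walk of positive length occur after its first step. -/
lemma encard_support_le {v : V} (c : G.Walk v v) (hc : 0 < c.length) :
    {x | x ∈ c.support}.encard ≤ c.length := by
  classical
  have h : {x | x ∈ c.support} = (c.support.tail.toFinset : Set V) := by
    ext x
    simp only [Set.mem_ofPred_eq, List.coe_toFinset]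
    constructor
    · intro hx
      cases c with
      | nil => simp at hc
      | cons h c =>
        rw [SimpleGraph.Walk.support_cons, List.mem_cons] at hx
        rcases hx with rfl | hx
        · simp
        · simpa using hx
    · exact List.mem_of_mem_tail
  rw [h, Set.encard_coe_eq_coe_finsetCard]
  refine (Nat.cast_le.mpr (List.toFinset_card_le _)).trans ?_
  simp

lemma cycle_length_le {v : V} {c : G.Walk v v} (hc : c.IsCycle) {Z : Set V}
    (hcZ : ∀ x ∈ c.support, x ∈ Z) {r : ℕ} (hZ : Z.encard ≤ r) : c.length ≤ r := by
  classical
  have h : (c.support.tail.toFinset : Set V) ⊆ Z := by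
    intro x hx
    exact hcZ x (List.mem_of_mem_tail (by simpa using hx))
  have h1 := (Set.encard_le_encard h).trans hZ
  rw [Set.encard_coe_eq_coe_finsetCard, List.toFinset_card_of_nodup hc.support_nodup] at h1
  simpa using h1

lemma IsLocallyChordal.isChordal_of_encard_le {r : ℕ} (hG : IsLocallyChordal G r)
    {Z : Set V} (hZ : Z.encard ≤ r) : IsChordal (G.induce Z) :=
  isChordal_induce fun _ _ hc h4 hsupp =>
    hG.exists_chord_of_length_le hc h4 (cycle_length_le hc hsupp hZ)

end Local

/-! ### The decomposition into maximal cliques -/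

section CliqueGraph

open SimpleGraph

variable {G : SimpleGraph V}

variable (G) in
/-- The type of maximal cliques of `G`, the nodes of the decomposition. -/
def MaxClique : Type u := {C : Set V // Maximal G.IsClique C}

lemma exists_maxClique {X : Set V} (hX : G.IsClique X) : ∃ C : MaxClique G, X ⊆ C.1 := by
  obtain ⟨C, hXC, hC⟩ := zorn_subset_nonempty {C | G.IsClique C} (fun c hc hchain _ => by
    refine ⟨⋃₀ c, ?_, fun s hs => Set.subset_sUnion_of_mem hs⟩
    rintro x ⟨s, hs, hxs⟩ y ⟨t, ht, hyt⟩ hxy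
    rcases hchain.total hs ht with h | h
    · exact hc ht (h hxs) hyt hxy
    · exact hc hs hxs (h hyt) hxy) X hX
  exact ⟨⟨C, hC⟩, hXC⟩

instance : Nonempty (MaxClique G) := ⟨(exists_maxClique (G.isClique_empty)).choose⟩

variable (G) in
/-- Two maximal cliques are joined if their intersection properly contains `X`. -/
def overlapGraph (X : Set V) : SimpleGraph (MaxClique G) where
  Adj C D := C ≠ D ∧ X ⊂ C.1 ∩ D.1
  symm := ⟨fun C D h => ⟨h.1.symm, by rw [Set.inter_comm]; exact h.2⟩⟩
  loopless := ⟨fun C h => h.1 rfl⟩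

/-- A representative of the component of `C` in the overlap graph of `X`. -/
noncomputable def cliqueRep (X : Set V) (C : MaxClique G) : MaxClique G :=
  ((overlapGraph G X).connectedComponentMk C).out

variable (G) in
/-- One of the representatives of the components of the overlap graph of `X` that consist of maximal
cliques containing `X` (an arbitrary node if there is no such clique). -/
noncomputable def cliqueRoot (X : Set V) : MaxClique G :=
  cliqueRep X (Classical.epsilon fun C => X ⊆ C.1)

lemma reachable_cliqueRep (X : Set V) (C : MaxClique G) :
    (overlapGraph G X).Reachable C (cliqueRep X C) :=
  ConnectedComponent.exact (Quot.out_eq _).symm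

lemma cliqueRep_eq_of_reachable {X : Set V} {C D : MaxClique G}
    (h : (overlapGraph G X).Reachable C D) : cliqueRep X C = cliqueRep X D := by
  rw [cliqueRep, cliqueRep, ConnectedComponent.sound h]

lemma cliqueRep_cliqueRep (X : Set V) (C : MaxClique G) :
    cliqueRep X (cliqueRep X C) = cliqueRep X C :=
  (cliqueRep_eq_of_reachable (reachable_cliqueRep X C)).symm

lemma cliqueRep_cliqueRoot (X : Set V) : cliqueRep X (cliqueRoot G X) = cliqueRoot G X :=
  cliqueRep_cliqueRep X _

lemma subset_of_reachable {X : Set V} {C D : MaxClique G}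
    (h : (overlapGraph G X).Reachable C D) (hC : X ⊆ C.1) : X ⊆ D.1 := by
  obtain ⟨p⟩ := h
  induction p with
  | nil => exact hC
  | cons h p ih => exact ih (h.2.subset.trans Set.inter_subset_right)

lemma subset_cliqueRep {X : Set V} {C : MaxClique G} (hC : X ⊆ C.1) : X ⊆ (cliqueRep X C).1 :=
  subset_of_reachable (reachable_cliqueRep X C) hC

lemma subset_cliqueRoot {X : Set V} {C : MaxClique G} (hC : X ⊆ C.1) : X ⊆ (cliqueRoot G X).1 :=
  subset_cliqueRep (Classical.epsilon_spec (p := fun C : MaxClique G => X ⊆ C.1) ⟨C, hC⟩)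

/-- Representatives of distinct components of the overlap graph of `X` intersect exactly in `X`. -/
lemma inter_eq_of_cliqueRep_eq {X : Set V} {C D : MaxClique G} (hC : X ⊆ C.1) (hD : X ⊆ D.1)
    (hCD : C ≠ D) (hrC : cliqueRep X C = C) (hrD : cliqueRep X D = D) : C.1 ∩ D.1 = X := by
  by_contra h
  have hadj : (overlapGraph G X).Adj C D :=
    ⟨hCD, (Set.subset_inter hC hD).ssubset_of_ne (Ne.symm h)⟩
  apply hCD
  rw [← hrC, ← hrD, cliqueRep_eq_of_reachable hadj.reachable]

variable (G) in
/-- The model graph on the maximal cliques of `G`: for every set `X`, the components of the overlap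
graph of `X` which consist of cliques containing `X` are joined by a star, whose edges run between
representatives of these components. Every edge `CD` belongs to the star of `X = C ∩ D`. -/
def cliqueGraph : SimpleGraph (MaxClique G) where
  Adj C D := C ≠ D ∧ cliqueRep (C.1 ∩ D.1) C = C ∧ cliqueRep (C.1 ∩ D.1) D = D ∧
    (C = cliqueRoot G (C.1 ∩ D.1) ∨ D = cliqueRoot G (C.1 ∩ D.1))
  symm := ⟨fun C D h => by
    rw [Set.inter_comm D.1 C.1]
    exact ⟨h.1.symm, h.2.2.1, h.2.1, h.2.2.2.symm⟩⟩
  loopless := ⟨fun C h => h.1 rfl⟩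

variable (G) in
/-- The subgraph of the model graph induced on the maximal cliques that contain `X`. -/
def cliqueStar (X : Set V) : (cliqueGraph G).Subgraph :=
  (⊤ : (cliqueGraph G).Subgraph).induce {C | X ⊆ C.1}

lemma cliqueStar_anti {X Y : Set V} (h : X ⊆ Y) : cliqueStar G Y ≤ cliqueStar G X :=
  Subgraph.induce_mono_right fun _ hC => h.trans hC

lemma cliqueStar_adj {X : Set V} {C D : MaxClique G} :
    (cliqueStar G X).Adj C D ↔ X ⊆ C.1 ∧ X ⊆ D.1 ∧ (cliqueGraph G).Adj C D := Iff.rfl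

/-- Downward induction on the nonempty cliques of a locally finite graph. -/
lemma clique_induction [G.LocallyFinite] {P : Set V → Prop}
    (h : ∀ X, X.Nonempty → G.IsClique X → (∀ Y, X ⊂ Y → G.IsClique Y → P Y) → P X)
    {X : Set V} (hne : X.Nonempty) (hX : G.IsClique X) : P X := by
  obtain ⟨v, hv⟩ := hne
  have hfin : (insert v (G.neighborSet v)).Finite := (Set.toFinite _).insert v
  have hsub : ∀ Y, v ∈ Y → G.IsClique Y → Y ⊆ insert v (G.neighborSet v) := by
    intro Y hvY hY y hy
    by_cases hyv : y = v
    · exact Or.inl hyv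
    · exact Or.inr (hY hvY hy (Ne.symm hyv))
  induction hn : (insert v (G.neighborSet v) \ X).ncard using Nat.strong_induction_on
    generalizing X with
  | _ n ih =>
  subst hn
  refine h X ⟨v, hv⟩ hX fun Y hXY hY => ih _ ?_ hY (hXY.subset hv) rfl
  apply Set.ncard_lt_ncard _ hfin.sdiff
  obtain ⟨y, hyY, hyX⟩ := Set.exists_of_ssubset hXY
  refine ⟨Set.sdiff_subset_sdiff_right hXY.subset, fun hle => ?_⟩
  exact (hle ⟨hsub Y (hXY.subset hv) hY hyY, hyX⟩).2 hyY

/-- The maximal cliques containing a given nonempty clique induce a connected subgraph. -/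
lemma cliqueStar_reachable [G.LocallyFinite] {X : Set V} (hne : X.Nonempty) (hX : G.IsClique X) :
    ∀ C ∈ (cliqueStar G X).verts, ∀ D ∈ (cliqueStar G X).verts,
      (cliqueStar G X).spanningCoe.Reachable C D := by
  refine clique_induction (P := fun X => ∀ C ∈ (cliqueStar G X).verts,
    ∀ D ∈ (cliqueStar G X).verts, (cliqueStar G X).spanningCoe.Reachable C D) ?_ hne hX
  intro X hne hX ih
  have hoverlap : ∀ C D, (overlapGraph G X).Reachable C D →
      (cliqueStar G X).spanningCoe.Reachable C D := by
    rintro C D ⟨p⟩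
    induction p with
    | nil => rfl
    | @cons A B _ h p ihp =>
      refine Reachable.trans ?_ ihp
      exact reachable_mono (cliqueStar_anti h.2.subset)
        (ih _ h.2 (A.2.prop.subset Set.inter_subset_left) A Set.inter_subset_left
          B Set.inter_subset_right)
  have hroot : ∀ C ∈ (cliqueStar G X).verts,
      (cliqueStar G X).spanningCoe.Reachable C (cliqueRoot G X) := by
    intro C hC
    refine (hoverlap _ _ (reachable_cliqueRep X C)).trans ?_
    by_cases heq : cliqueRep X C = cliqueRoot G X
    · rw [heq]
    · have hC' := subset_cliqueRep hC
      have hR := subset_cliqueRoot hC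
      have hinter := inter_eq_of_cliqueRep_eq hC' hR heq (cliqueRep_cliqueRep X C)
        (cliqueRep_cliqueRoot X)
      refine Adj.reachable (?_ : (cliqueStar G X).Adj _ _)
      refine cliqueStar_adj.mpr ⟨hC', hR, heq, ?_⟩
      rw [hinter]
      exact ⟨cliqueRep_cliqueRep X C, cliqueRep_cliqueRoot X, Or.inr rfl⟩
  intro C hC D hD
  exact (hroot C hC).trans (hroot D hD).symm

lemma isClique_insert_of_forall {X : Set V} (hX : G.IsClique X) {y : V} (hy : ∀ x ∈ X, G.Adj x y) :
    G.IsClique (insert y X) :=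
  hX.insert fun x hx _ => (hy x hx).symm

/-- Let `Z` be a set of common neighbours of the clique `X` that induces a chordal graph. Cut
functions of the subgraphs `cliqueStar G (X ∪ {y})` for `y ∈ Z` can be chosen alike: the amounts by
which they differ form a cocycle on `Z`, which vanishes on triangles since the vertices of a
triangle lie, together with `X`, in a maximal clique. -/
lemma exists_common_isCut [G.LocallyFinite] {X Z : Set V} (hX : G.IsClique X)
    (hZ : ∀ y ∈ Z, ∀ x ∈ X, G.Adj x y) (hch : IsChordal (G.induce Z)) {e : Sym2 (MaxClique G)}
    (hcut : ∀ y ∈ Z, ∃ q, IsCut (cliqueStar G (insert y X)) e q) :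
    ∃ q, ∀ y ∈ Z, IsCut (cliqueStar G (insert y X)) e q := by
  classical
  have hcl : ∀ y ∈ Z, G.IsClique (insert y X) := fun y hy => isClique_insert_of_forall hX (hZ y hy)
  have hcl2 : ∀ y ∈ Z, ∀ z ∈ Z, G.Adj y z → G.IsClique (insert z (insert y X)) := by
    intro y hy z hz hyz
    refine isClique_insert_of_forall (hcl y hy) fun x hx => ?_
    rcases hx with rfl | hx
    · exact hyz
    · exact hZ z hz x hx
  let s : V → MaxClique G → ZMod 2 := fun y => if hy : y ∈ Z then (hcut y hy).choose else 0
  have hs : ∀ y ∈ Z, IsCut (cliqueStar G (insert y X)) e (s y) := by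
    intro y hy
    simp only [s, dif_pos hy]
    exact (hcut y hy).choose_spec
  have hdiff : ∀ y z : Z, ∃ a : ZMod 2, (G.induce Z).Adj y z →
      ∀ C : MaxClique G, insert (y : V) X ⊆ C.1 → insert (z : V) X ⊆ C.1 → s y C + s z C = a := by
    intro y z
    by_cases hyz : (G.induce Z).Adj y z
    · have hc := hcl2 y y.2 z z.2 hyz
      obtain ⟨C₀, hC₀⟩ := exists_maxClique hc
      refine ⟨s y C₀ + s z C₀, fun _ C hy hz => ?_⟩
      have h1 : insert (y : V) X ⊆ insert (z : V) (insert (y : V) X) := Set.subset_insert _ _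
      have h2 : insert (z : V) X ⊆ insert (z : V) (insert (y : V) X) :=
        Set.insert_subset_insert (Set.subset_insert _ _)
      refine ((hs y y.2).mono (cliqueStar_anti h1)).add_eq_add
        ((hs z z.2).mono (cliqueStar_anti h2))
        (cliqueStar_reachable ⟨_, Set.mem_insert _ _⟩ hc C ?_ C₀ hC₀)
      exact Set.insert_subset (hz (Set.mem_insert _ _)) hy
    · exact ⟨0, fun h => absurd h hyz⟩
  choose φ hφ using hdiff
  have hsymm : ∀ y z, (G.induce Z).Adj y z → φ y z = φ z y := by
    intro y z hyz
    obtain ⟨C, hC⟩ := exists_maxClique (hcl2 y y.2 z z.2 hyz)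
    have hy : insert (y : V) X ⊆ C.1 := (Set.subset_insert _ _).trans hC
    have hz : insert (z : V) X ⊆ C.1 :=
      (Set.insert_subset_insert (Set.subset_insert _ _)).trans hC
    rw [← hφ y z hyz C hy hz, ← hφ z y hyz.symm C hz hy, add_comm]
  have htri : ∀ x y z, (G.induce Z).Adj x y → (G.induce Z).Adj y z → (G.induce Z).Adj z x →
      φ x y + φ y z + φ z x = 0 := by
    intro x y z hxy hyz hzx
    obtain ⟨C, hC⟩ := exists_maxClique (isClique_insert_of_forall (hcl2 x x.2 y y.2 hxy)
      (y := z) (by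
        rintro a (rfl | rfl | ha)
        · exact hyz
        · exact hzx.symm
        · exact hZ z z.2 a ha))
    have hXC : X ⊆ C.1 := fun a ha => hC (Or.inr (Or.inr (Or.inr ha)))
    have hx : insert (x : V) X ⊆ C.1 := Set.insert_subset (hC (Or.inr (Or.inr (Or.inl rfl)))) hXC
    have hy : insert (y : V) X ⊆ C.1 := Set.insert_subset (hC (Or.inr (Or.inl rfl))) hXC
    have hz : insert (z : V) X ⊆ C.1 := Set.insert_subset (hC (Or.inl rfl)) hXC
    rw [← hφ x y hxy C hx hy, ← hφ y z hyz C hy hz, ← hφ z x hzx C hz hx]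
    grind
  obtain ⟨p, hp⟩ := exists_potential hsymm fun v c hc => hch.walkSum_eq_zero hsymm htri v c hc
  refine exists_isCut_of_potential (K := fun y => cliqueStar G (insert y X)) s hs
    (fun y => if hy : y ∈ Z then p ⟨y, hy⟩ else 0) fun y hy z hz hyz C hC hC' => ?_
  have hadj : G.Adj y z := C.2.prop (hC (Set.mem_insert _ _)) (hC' (Set.mem_insert _ _)) hyz
  rw [dif_pos hy, dif_pos hz, hφ ⟨y, hy⟩ ⟨z, hz⟩ hadj C hC hC']
  exact hp ⟨y, hy⟩ ⟨z, hz⟩ hadj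

/-- In a locally chordal graph, the maximal cliques containing a given nonempty clique induce an
acyclic subgraph of the model graph. -/
lemma exists_isCut_cliqueStar [G.LocallyFinite] {r : ℕ} (hr : 3 ≤ r) (hG : IsLocallyChordal G r)
    {X : Set V} (hne : X.Nonempty) (hX : G.IsClique X) (e : Sym2 (MaxClique G)) :
    ∃ q, IsCut (cliqueStar G X) e q := by
  classical
  refine clique_induction (P := fun X => ∃ q, IsCut (cliqueStar G X) e q) ?_ hne hX
  intro X hne hX ih
  -- the edges inside the components of the overlap graph keep the representative
  have hrep : ∀ C D, (cliqueStar G X).Adj C D → C.1 ∩ D.1 ≠ X → cliqueRep X C = cliqueRep X D := by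
    intro C D h hI
    obtain ⟨hC, hD, hadj⟩ := cliqueStar_adj.mp h
    exact cliqueRep_eq_of_reachable (Adj.reachable
      ⟨hadj.1, (Set.subset_inter hC hD).ssubset_of_ne (Ne.symm hI)⟩)
  have hstar : ∀ C D, (cliqueGraph G).Adj C D → C.1 ∩ D.1 = X → C ≠ D ∧ cliqueRep X C = C ∧
      cliqueRep X D = D ∧ (C = cliqueRoot G X ∨ D = cliqueRoot G X) := by
    rintro C D h rfl
    exact h
  by_cases he : ∃ D, D ≠ cliqueRoot G X ∧ cliqueRep X D = D ∧ e = s(cliqueRoot G X, D)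
  · obtain ⟨D, hDr, hD, rfl⟩ := he
    by_cases hXD : X ⊆ D.1
    · refine ⟨fun C => if cliqueRep X C = D then 1 else 0, fun A B hAB => ?_⟩
      obtain ⟨hA, hB, hadj⟩ := cliqueStar_adj.mp hAB
      have hDX := inter_eq_of_cliqueRep_eq (subset_cliqueRoot hXD) hXD hDr.symm
        (cliqueRep_cliqueRoot X) hD
      by_cases hI : A.1 ∩ B.1 = X
      · obtain ⟨hne', hrA, hrB, h | h⟩ := hstar A B hadj hI
        · subst h
          simp only [hrA, hrB, if_neg hDr.symm, zero_add, Sym2.eq_iff]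
          grind
        · subst h
          simp only [hrA, hrB, if_neg hDr.symm, add_zero, Sym2.eq_iff]
          grind
      · simp only [hrep A B hAB hI, zmod_two_add_self]
        rw [if_neg]
        intro h
        apply hI
        rw [← hDX]
        rcases Sym2.eq_iff.mp h with ⟨rfl, rfl⟩ | ⟨rfl, rfl⟩
        · rfl
        · exact Set.inter_comm _ _
    · refine ⟨0, fun A B hAB => ?_⟩
      obtain ⟨hA, hB, hadj⟩ := cliqueStar_adj.mp hAB
      rw [if_neg]
      · simp
      · intro h
        rcases Sym2.eq_iff.mp h with ⟨rfl, rfl⟩ | ⟨rfl, rfl⟩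
        · exact hXD hB
        · exact hXD hA
  · -- subtracting the value at the representative extends a cut function for the other edges to
    -- the star of `X`
    have hZne : ∀ y, (∀ x ∈ X, G.Adj x y) → X ⊂ insert y X := fun y hy =>
      Set.ssubset_insert fun h => G.irrefl (hy y h)
    obtain ⟨x₀, hx₀⟩ := hne
    obtain ⟨q, hq⟩ := exists_common_isCut (Z := {y | ∀ x ∈ X, G.Adj x y}) (e := e) hX
      (fun y hy => hy) (hG.isChordal_link hr (z := x₀) fun y hy => hy x₀ hx₀)
      fun y hy => ih _ (hZne y hy) (isClique_insert_of_forall hX hy)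
    refine ⟨fun C => q C + q (cliqueRep X C), fun A B hAB => ?_⟩
    obtain ⟨hA, hB, hadj⟩ := cliqueStar_adj.mp hAB
    by_cases hI : A.1 ∩ B.1 = X
    · obtain ⟨hne', hrA, hrB, h⟩ := hstar A B hadj hI
      simp only [hrA, hrB, zmod_two_add_self, add_zero]
      rw [if_neg]
      rintro rfl
      apply he
      rcases h with rfl | rfl
      · exact ⟨B, hne'.symm, hrB, rfl⟩
      · exact ⟨A, hne', hrA, Sym2.eq_swap⟩
    · obtain ⟨y, hy, hyX⟩ := Set.exists_of_ssubset
        ((Set.subset_inter hA hB).ssubset_of_ne (Ne.symm hI))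
      have hyZ : ∀ x ∈ X, G.Adj x y := fun x hx =>
        A.2.prop (hA hx) hy.1 (by rintro rfl; exact hyX hx)
      have h1 := hq y hyZ A B (cliqueStar_adj.mpr
        ⟨Set.insert_subset hy.1 hA, Set.insert_subset hy.2 hB, hadj⟩)
      simp only [hrep A B hAB hI, ← h1]
      grind

/-- A locally finite, `r`-locally chordal graph has an `r`-acyclic decomposition into cliques all of
whose co-parts are induced subgraphs of the model graph. -/
theorem exists_induced_decomposition [G.LocallyFinite] {r : ℕ} (hr : 3 ≤ r)
    (hG : IsLocallyChordal G r) :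
    ∃ (N : Type u) (H : SimpleGraph N) (bag : N → Set V) (K : V → H.Subgraph),
      IsGraphDecompositionIntoCliques G H bag K ∧ IsRAcyclic r K ∧
        ∀ v, K v = (⊤ : H.Subgraph).induce (cobag bag v) := by
  let K : V → (cliqueGraph G).Subgraph := fun v => cliqueStar G (insert v ∅)
  have hverts : ∀ v, (K v).verts = cobag (fun C : MaxClique G => C.1) v := by
    intro v
    ext C
    change insert v ∅ ⊆ C.1 ↔ v ∈ C.1
    simp
  have hK : ∀ v, K v = (⊤ : (cliqueGraph G).Subgraph).induce (cobag (fun C => C.1) v) := by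
    intro v
    rw [← hverts v]
    rfl
  have hsingle : ∀ v, G.IsClique (insert v ∅) := fun v => by simp
  have hconn : ∀ v, (K v).Connected := by
    intro v
    rw [connected_iff_reachable]
    obtain ⟨C, hC⟩ := exists_maxClique (hsingle v)
    exact ⟨⟨C, hC⟩, cliqueStar_reachable ⟨v, Set.mem_insert _ _⟩ (hsingle v)⟩
  refine ⟨MaxClique G, cliqueGraph G, fun C => C.1, K, ⟨⟨?_, ?_⟩, ⟨hverts, hconn⟩,
    fun C => C.2.prop⟩, ?_, hK⟩
  · apply Subgraph.ext
    · rw [Subgraph.verts_iSup]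
      refine Set.eq_univ_of_forall fun v => ?_
      obtain ⟨C, hC⟩ := exists_maxClique (hsingle v)
      exact Set.mem_iUnion.mpr ⟨C, hC (Set.mem_insert _ _)⟩
    · ext x y
      rw [Subgraph.iSup_adj]
      constructor
      · rintro ⟨C, h⟩
        exact h.2.2
      · intro h
        obtain ⟨C, hC⟩ := exists_maxClique (G := G) (X := {x, y}) (by
          rw [isClique_pair]; exact fun _ => h)
        exact ⟨C, hC (by simp), hC (by simp), h⟩
  · intro v
    rw [connected_induce_iff, ← hK]
    exact hconn v
  · intro Z hZ
    rw [isAcyclic_biSup_coe_iff]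
    intro e
    exact exists_common_isCut (X := ∅) (G.isClique_empty) (by simp)
      (hG.isChordal_of_encard_le hZ)
      fun y _ => exists_isCut_cliqueStar hr hG ⟨y, Set.mem_insert _ _⟩ (hsingle y) e

end CliqueGraph

/-! ### Acyclic regions induce tree-decompositions of balls -/

section Regions

variable {G : SimpleGraph V} {H : SimpleGraph N} {bag : N → Set V} {K : V → H.Subgraph} {r : ℕ}

lemma IsCopartFamily.mem_verts_iff (hK : IsCopartFamily H bag K) {v : V} {h : N} :
    h ∈ (K v).verts ↔ v ∈ bag h := by
  rw [hK.verts_eq]; rfl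

/-- The co-parts of a decomposition into cliques form a region representation. -/
lemma IsGraphDecompositionIntoCliques.isRegionRepresentation
    (hD : IsGraphDecompositionIntoCliques G H bag K) : IsRegionRepresentation G H K := by
  refine ⟨hD.coparts.connected, fun u v huv => ⟨fun h => ?_, ?_⟩⟩
  · have h1 : (⨆ h, (⊤ : G.Subgraph).induce (bag h)).Adj u v := by
      rw [hD.decomp.union_parts]; exact h
    rw [SimpleGraph.Subgraph.iSup_adj] at h1
    obtain ⟨h, hu, hv, _⟩ := h1
    exact ⟨h, hD.coparts.mem_verts_iff.mpr hu, hD.coparts.mem_verts_iff.mpr hv⟩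
  · rintro ⟨h, hu, hv⟩
    exact hD.cliques h (hD.coparts.mem_verts_iff.mp hu) (hD.coparts.mem_verts_iff.mp hv) huv

/-- The regions of a region representation are co-parts of a decomposition into cliques, whose bags
are the sets of vertices with a common node. -/
lemma IsRegionRepresentation.isGraphDecompositionIntoCliques
    (hR : IsRegionRepresentation G H K) :
    IsGraphDecompositionIntoCliques G H (fun h => {v | h ∈ (K v).verts}) K := by
  refine ⟨⟨?_, fun v => (hR.region v).induce_verts⟩, ⟨fun v => rfl, hR.region⟩, ?_⟩
  · apply SimpleGraph.Subgraph.ext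
    · rw [SimpleGraph.Subgraph.verts_iSup]
      refine Set.eq_univ_of_forall fun v => ?_
      obtain ⟨h, hh⟩ := (hR.region v).nonempty
      exact Set.mem_iUnion.mpr ⟨h, hh⟩
    · ext x y
      rw [SimpleGraph.Subgraph.iSup_adj]
      refine ⟨fun ⟨h, hxy⟩ => hxy.2.2, fun h => ?_⟩
      obtain ⟨n, hx, hy⟩ := (hR.adj_iff x y (SimpleGraph.Adj.ne h)).mp h
      exact ⟨n, hx, hy, h⟩
  · intro h u hu v hv huv
    exact (hR.adj_iff u v huv).mpr ⟨h, hu, hv⟩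

lemma IsRAcyclic.exists_isCut (hA : IsRAcyclic r K) {Z : Set V} (hZ : Z.encard ≤ r) (e : Sym2 N) :
    ∃ q, ∀ x ∈ Z, IsCut (K x) e q :=
  isAcyclic_biSup_coe_iff.mp (hA Z hZ) e

lemma IsRAcyclic.isAcyclic (hr : 1 ≤ r) (hA : IsRAcyclic r K) (v : V) : (K v).coe.IsAcyclic := by
  rw [isAcyclic_coe_iff]
  intro e
  obtain ⟨q, hq⟩ := hA.exists_isCut (Z := {v}) (by rw [Set.encard_singleton]; exact_mod_cast hr) e
  exact ⟨q, hq v rfl⟩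

lemma IsRAcyclic.isAcyclic_sup (hr : 2 ≤ r) (hA : IsRAcyclic r K) (u v : V) :
    (K u ⊔ K v).coe.IsAcyclic := by
  have h := hA {u, v} ((Set.encard_insert_le _ _).trans (by
    rw [Set.encard_singleton, one_add_one_eq_two]; exact_mod_cast hr))
  rwa [iSup_pair] at h

/-- Adjacent vertices have connected intersections of regions. -/
lemma IsRegionRepresentation.connected_inf (hR : IsRegionRepresentation G H K) (hr : 2 ≤ r)
    (hA : IsRAcyclic r K) {u v : V} (huv : G.Adj u v) : (K u ⊓ K v).Connected :=
  LocChordal.connected_inf (hR.region u) (hR.region v) (hA.isAcyclic_sup hr u v)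
    ((hR.adj_iff u v huv.ne).mp huv)

/-- Given an `r`-acyclic region representation, the amounts `φ` by which the cut functions `s` of
the regions of adjacent vertices differ form a cocycle, whose sum along each closed walk of length
at most `r` is zero: there is a common cut function for the vertices of such a walk. -/
lemma IsRegionRepresentation.exists_cocycle (hR : IsRegionRepresentation G H K) (hr : 2 ≤ r)
    (hA : IsRAcyclic r K) (e : Sym2 N) :
    ∃ (s : V → N → ZMod 2) (φ : V → V → ZMod 2), (∀ v, IsCut (K v) e (s v)) ∧
      (∀ u v, G.Adj u v → ∀ h ∈ (K u).verts, h ∈ (K v).verts → s u h + s v h = φ u v) ∧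
      (∀ u v, G.Adj u v → φ u v = φ v u) ∧
      ∀ (v : V) (c : G.Walk v v), c.length ≤ r → walkSum φ c = 0 := by
  have h1 : ∀ v, ∃ q, IsCut (K v) e q := fun v =>
    isAcyclic_coe_iff.mp (hA.isAcyclic (by omega) v) e
  choose s hs using h1
  have h2 : ∀ u v, ∃ a : ZMod 2, G.Adj u v → ∀ h ∈ (K u).verts, h ∈ (K v).verts →
      s u h + s v h = a := by
    intro u v
    by_cases huv : G.Adj u v
    · have hc := hR.connected_inf hr hA huv
      obtain ⟨h₀, hh₀⟩ := hc.nonempty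
      exact ⟨s u h₀ + s v h₀, fun _ h hu hv => ((hs u).mono inf_le_left).add_eq_add
        ((hs v).mono inf_le_right) (reachable_of_connected hc ⟨hu, hv⟩ hh₀)⟩
    · exact ⟨0, fun h => absurd h huv⟩
  choose φ hφ using h2
  refine ⟨s, φ, hs, hφ, fun u v huv => ?_, fun v c hc => ?_⟩
  · obtain ⟨h, hu, hv⟩ := (hR.adj_iff u v huv.ne).mp huv
    rw [← hφ u v huv h hu hv, ← hφ v u huv.symm h hv hu, add_comm]
  · rcases Nat.eq_zero_or_pos c.length with h0 | hpos
    · rw [(SimpleGraph.Walk.length_eq_zero_iff.mp h0).eq_nil, walkSum_nil]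
    · obtain ⟨q, hq⟩ := hA.exists_isCut (Z := {x | x ∈ c.support})
        ((encard_support_le c hpos).trans (by exact_mod_cast hc)) e
      have h3 : ∀ x, ∃ a : ZMod 2, x ∈ c.support → ∀ h ∈ (K x).verts, s x h + q h = a := by
        intro x
        obtain ⟨h₀, hh₀⟩ := (hR.region x).nonempty
        exact ⟨s x h₀ + q h₀, fun hx h hh => (hs x).add_eq_add (hq x hx)
          (reachable_of_connected (hR.region x) hh hh₀)⟩
      choose p hp using h3
      rw [walkSum_of_potential (p := p) c, zmod_two_add_self]
      intro x hx y hy hxy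
      obtain ⟨h, hhx, hhy⟩ := (hR.adj_iff x y hxy.ne).mp hxy
      rw [← hφ x y hxy h hhx hhy, ← hp x hx h hhx, ← hp y hy h hhy]
      grind

/-- If the vertices in `Z` and the edges between them lie on short closed walks through `v`, then
the union of the regions of all vertices in `Z` is acyclic, whatever the size of `Z` may be: summing
the cocycle along shortest walks from `v` yields a potential. -/
lemma IsRegionRepresentation.isAcyclic_biSup (hR : IsRegionRepresentation G H K) (hr : 2 ≤ r)
    (hA : IsRAcyclic r K) {v : V} {Z : Set V} (hZ : ∀ x ∈ Z, G.edist v x ≠ ⊤)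
    (hZZ : ∀ x ∈ Z, ∀ y ∈ Z, G.Adj x y → G.edist v x + G.edist v y < r) :
    (⨆ x ∈ Z, K x).coe.IsAcyclic := by
  classical
  rw [isAcyclic_biSup_coe_iff]
  intro e
  obtain ⟨s, φ, hs, hφ, hsymm, hsum⟩ := hR.exists_cocycle hr hA e
  have hw : ∀ x ∈ Z, ∃ p : G.Walk v x, p.length = G.edist v x := fun x hx =>
    SimpleGraph.exists_walk_of_edist_ne_top (hZ x hx)
  choose p hp using hw
  refine exists_isCut_of_potential s (fun x _ => hs x)
    (fun x => if hx : x ∈ Z then walkSum φ (p x hx) else 0) fun x hx y hy hxy h hhx hhy => ?_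
  have hadj : G.Adj x y := (hR.adj_iff x y hxy).mpr ⟨h, hhx, hhy⟩
  rw [dif_pos hx, dif_pos hy, hφ x y hadj h hhx hhy]
  have hlen : ((p x hx).append ((p y hy).reverse.cons hadj)).length ≤ r := by
    have := hZZ x hx y hy hadj
    rw [← hp x hx, ← hp y hy] at this
    rw [SimpleGraph.Walk.length_append, SimpleGraph.Walk.length_cons,
      SimpleGraph.Walk.length_reverse]
    norm_cast at this
  have := hsum v _ hlen
  rw [walkSum_append, walkSum_cons, walkSum_reverse hsymm] at this
  grind

lemma exists_adj_edist_eq {v x : V} {n : ℕ} (h : G.edist v x = (n + 1 : ℕ)) :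
    ∃ y, G.Adj y x ∧ G.edist v y = n := by
  obtain ⟨p, hp⟩ := SimpleGraph.exists_walk_of_edist_eq_coe h
  have hadj : G.Adj (p.getVert n) x := by
    have := p.adj_getVert_succ (i := n) (by omega)
    rwa [← hp, p.getVert_length] at this
  refine ⟨p.getVert n, hadj, le_antisymm (edist_getVert_le p n) ?_⟩
  have h1 : G.edist v x ≤ G.edist v (p.getVert n) + G.edist (p.getVert n) x :=
    SimpleGraph.edist_triangle
  rw [SimpleGraph.edist_eq_one_iff_adj.mpr hadj, h] at h1
  push_cast at h1
  exact (ENat.add_le_add_iff_right (by simp)).mp h1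

lemma localModel_verts {v : V} {h : N} :
    h ∈ (localModel G K r v).verts ↔ ∃ x, 2 * G.edist v x < r ∧ h ∈ (K x).verts := by
  simp [localModel]

lemma le_localModel {v x : V} (hx : 2 * G.edist v x < r) : K x ≤ localModel G K r v :=
  le_iSup₂_of_le x hx le_rfl

lemma edist_ne_top_of_two_mul_le {v x : V} (h : 2 * G.edist v x ≤ r) : G.edist v x ≠ ⊤ := by
  intro ht
  simp [ht] at h

lemma edist_add_lt {v x y : V} (hx : 2 * G.edist v x ≤ r) (hy : 2 * G.edist v y < r) :
    G.edist v x + G.edist v y < r := by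
  have h1 := edist_ne_top_of_two_mul_le hx
  have h2 := edist_ne_top_of_two_mul_le hy.le
  generalize G.edist v x = a at *
  generalize G.edist v y = b at *
  lift a to ℕ using h1
  lift b to ℕ using h2
  norm_cast at *
  omega

/-- The regions of the vertices at distance at most `n` from `v` hang together. -/
lemma IsRegionRepresentation.reachable_of_edist_le (hR : IsRegionRepresentation G H K)
    {M : H.Subgraph} {v : V} {n : ℕ} (hM : ∀ x, G.edist v x ≤ n → K x ≤ M) {x : V}
    (hx : G.edist v x ≤ n) {h₀ h : N} (hh₀ : h₀ ∈ (K v).verts) (hh : h ∈ (K x).verts) :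
    M.spanningCoe.Reachable h₀ h := by
  obtain ⟨m, hm⟩ := ENat.ne_top_iff_exists.mp (ne_top_of_le_ne_top (by simp) hx)
  induction m generalizing x h with
  | zero =>
    obtain rfl : v = x := by
      rw [← SimpleGraph.edist_eq_zero_iff (G := G), ← hm]; rfl
    exact reachable_mono (hM v hx) (reachable_of_connected (hR.region v) hh₀ hh)
  | succ m ih =>
    obtain ⟨y, hyx, hy⟩ := exists_adj_edist_eq hm.symm
    obtain ⟨h', hy', hx'⟩ := (hR.adj_iff y x hyx.ne).mp hyx
    refine (ih (x := y) (h := h') ?_ hy' hy.symm).trans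
      (reachable_mono (hM x hx) (reachable_of_connected (hR.region x) hx' hh))
    rw [hy]
    rw [← hm] at hx
    refine le_trans ?_ hx
    norm_cast
    omega

lemma reachable_comap {A M : H.Subgraph} {a b : M.verts}
    (h : (A ⊓ M).spanningCoe.Reachable (a : N) b) :
    (A.comap M.hom).spanningCoe.Reachable a b := by
  obtain ⟨p⟩ := h
  have : ∀ {x y : N} (p : (A ⊓ M).spanningCoe.Walk x y) (hx : x ∈ M.verts) (hy : y ∈ M.verts),
      (A.comap M.hom).spanningCoe.Reachable ⟨x, hx⟩ ⟨y, hy⟩ := by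
    intro x y p
    induction p with
    | nil => intros; rfl
    | @cons x z y hadj p ih =>
      intro hx hy
      have hz : z ∈ M.verts := M.edge_vert hadj.2.symm
      refine SimpleGraph.Reachable.trans (SimpleGraph.Adj.reachable
        (?_ : (A.comap M.hom).Adj ⟨x, hx⟩ ⟨z, hz⟩)) (ih hz hy)
      exact ⟨hadj.2, hadj.1⟩
  exact this p a.2 b.2

/-- The regions of the vertices in the ball around `v` meet the local model graph in subtrees. -/
lemma IsRegionRepresentation.connected_inf_localModel (hR : IsRegionRepresentation G H K)
    (hr : 2 ≤ r) (hA : IsRAcyclic r K) {v x : V} (hx : 2 * G.edist v x ≤ r)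
    (hM : (localModel G K r v).Connected) : (K x ⊓ localModel G K r v).Connected := by
  refine LocChordal.connected_inf (hR.region x) hM ?_ ?_
  · rw [localModel, ← iSup_insert]
    refine hR.isAcyclic_biSup hr hA (v := v) ?_ ?_
    · rintro y (rfl | hy)
      · exact edist_ne_top_of_two_mul_le hx
      · exact edist_ne_top_of_two_mul_le (le_of_lt hy)
    · rintro y (rfl | hy) z (rfl | hz) hyz
      · exact absurd hyz G.irrefl
      · exact edist_add_lt hx hz
      · rw [add_comm]; exact edist_add_lt hx hy
      · exact edist_add_lt (le_of_lt hy) hz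
  · by_cases hlt : 2 * G.edist v x < r
    · obtain ⟨h, hh⟩ := (hR.region x).nonempty
      exact ⟨h, hh, (le_localModel hlt).1 hh⟩
    · obtain ⟨m, hm⟩ := ENat.ne_top_iff_exists.mp (edist_ne_top_of_two_mul_le hx)
      cases m with
      | zero => exact absurd (by rw [← hm]; norm_cast; omega) hlt
      | succ m =>
        obtain ⟨y, hyx, hy⟩ := exists_adj_edist_eq hm.symm
        obtain ⟨h, hhy, hhx⟩ := (hR.adj_iff y x hyx.ne).mp hyx
        refine ⟨h, hhx, (le_localModel ?_).1 hhy⟩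
        rw [hy]
        rw [← hm] at hx
        norm_cast at hx ⊢
        omega

/-- An `r`-acyclic decomposition into cliques locally induces tree-decompositions. -/
theorem IsGraphDecompositionIntoCliques.locallyInducesTreeDecompositions
    (hD : IsGraphDecompositionIntoCliques G H bag K) (hr : 2 ≤ r) (hA : IsRAcyclic r K) :
    LocallyInducesTreeDecompositions G bag K r := by
  intro v
  have hR := hD.isRegionRepresentation
  have hv : 2 * G.edist v v < r := by
    rw [SimpleGraph.edist_self]; norm_cast; omega
  have hM : (localModel G K r v).Connected := by
    obtain ⟨h₀, hh₀⟩ := (hR.region v).nonempty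
    have key : ∀ h ∈ (localModel G K r v).verts,
        (localModel G K r v).spanningCoe.Reachable h₀ h := by
      intro h hh
      obtain ⟨x, hx, hhx⟩ := localModel_verts.mp hh
      obtain ⟨m, hm⟩ := ENat.ne_top_iff_exists.mp (edist_ne_top_of_two_mul_le hx.le)
      refine hR.reachable_of_edist_le (v := v) (n := m) (fun y hy => le_localModel ?_)
        hm.ge hh₀ hhx
      exact (mul_le_mul_right hy 2).trans_lt (hm ▸ hx)
    rw [connected_iff_reachable]
    exact ⟨⟨h₀, (le_localModel hv).1 hh₀⟩, fun a ha b hb => (key a ha).symm.trans (key b hb)⟩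
  have hMacyc : (localModel G K r v).coe.IsAcyclic :=
    hR.isAcyclic_biSup hr hA (v := v) (fun y hy => edist_ne_top_of_two_mul_le (le_of_lt hy))
      fun y hy z hz _ => edist_add_lt (le_of_lt hy) hz
  have hcopart : IsCopartFamily (localModel G K r v).coe (localBag G bag K r v)
      (localCopart G K r v) := by
    refine ⟨fun x => ?_, fun x => ?_⟩
    · ext h
      exact hD.coparts.mem_verts_iff
    · have hc := hR.connected_inf_localModel hr hA x.2 hM
      obtain ⟨h, hhx, hhM⟩ := hc.nonempty
      rw [connected_iff_reachable]
      exact ⟨⟨⟨h, hhM⟩, hhx⟩, fun a ha b hb =>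
        reachable_comap (reachable_of_connected hc ⟨ha, a.2⟩ ⟨hb, b.2⟩)⟩
  refine ⟨⟨hM.coe, hMacyc⟩, ⟨?_, fun x => ?_⟩, hcopart⟩
  · apply SimpleGraph.Subgraph.ext
    · rw [SimpleGraph.Subgraph.verts_iSup]
      refine Set.eq_univ_of_forall fun x => ?_
      obtain ⟨h, hh⟩ := (hcopart.connected x).nonempty
      rw [hcopart.verts_eq] at hh
      exact Set.mem_iUnion.mpr ⟨h, hh⟩
    · ext x y
      rw [SimpleGraph.Subgraph.iSup_adj]
      refine ⟨fun ⟨h, hxy⟩ => hxy.2.2, fun hxy => ?_⟩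
      have hxy' : (ball G r v).Adj x y := hxy
      obtain ⟨h, hhx, hhy⟩ := (hR.adj_iff x y hxy'.1.ne).mp hxy'.1
      have hor : 2 * G.edist v x < r ∨ 2 * G.edist v y < r := by
        have h1 := edist_ne_top_of_two_mul_le x.2
        have h2 := edist_ne_top_of_two_mul_le y.2
        have h3 := hxy'.2
        generalize G.edist v x = a at *
        generalize G.edist v y = b at *
        lift a to ℕ using h1
        lift b to ℕ using h2
        norm_cast at *
        omega
      have hhM : h ∈ (localModel G K r v).verts := by
        rcases hor with h' | h'
        · exact (le_localModel h').1 hhx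
        · exact (le_localModel h').1 hhy
      exact ⟨⟨h, hhM⟩, hD.coparts.mem_verts_iff.mp hhx, hD.coparts.mem_verts_iff.mp hhy, hxy⟩
  · rw [← hcopart.verts_eq]
    exact (hcopart.connected x).induce_verts

end Regions

/-! ### Balls with locally induced tree-decompositions are chordal -/

section Balls

variable {G : SimpleGraph V} {H : SimpleGraph N} {bag : N → Set V} {K : V → H.Subgraph} {r : ℕ}

/-- On a cycle without chords, only consecutive vertices are adjacent. -/
lemma index_of_adj_of_chordless {v : V} {c : G.Walk v v} (hc : c.IsCycle)
    (hch : ∀ x ∈ c.support, ∀ y ∈ c.support, G.Adj x y → s(x, y) ∈ c.edges) {i j : ℕ} (hij : i < j)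
    (hj : j < c.length) (hadj : G.Adj (c.getVert i) (c.getVert j)) :
    j = i + 1 ∨ (i = 0 ∧ j = c.length - 1) := by
  have hmem := hch _ (c.getVert_mem_support i) _ (c.getVert_mem_support j) hadj
  rw [SimpleGraph.Walk.mk_mem_edges_iff_exists] at hmem
  obtain ⟨k, hk, heq⟩ := hmem
  have hinj : ∀ {a b : ℕ}, a ≤ c.length - 1 → b ≤ c.length - 1 →
      c.getVert a = c.getVert b → a = b :=
    fun ha hb h => hc.getVert_injOn' ha hb h
  by_cases hk' : k + 1 ≤ c.length - 1
  · rcases Sym2.eq_iff.mp heq with ⟨h1, h2⟩ | ⟨h1, h2⟩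
    · have := hinj (by omega) (by omega) h1
      have := hinj (by omega) (by omega) h2
      omega
    · have := hinj (by omega) (by omega) h1
      have := hinj (by omega) (by omega) h2
      omega
  · have h0 : c.getVert (k + 1) = c.getVert 0 := by
      rw [show k + 1 = c.length by omega, c.getVert_length, c.getVert_zero]
    rw [h0] at heq
    rcases Sym2.eq_iff.mp heq with ⟨h1, h2⟩ | ⟨h1, h2⟩
    · have := hinj (by omega) (by omega) h1
      have := hinj (by omega) (by omega) h2
      omega
    · have := hinj (by omega) (by omega) h1
      have := hinj (by omega) (by omega) h2
      omega

/-- Suppose that connected subgraphs of a forest meet whenever their indices are adjacent in `G`.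
Then a cycle of length at least four without chords has non-adjacent vertices whose subgraphs meet:
otherwise the first, the second and the last subgraph and the union of the remaining ones would
form a cycle of length four. -/
lemma exists_inter_nonempty_of_chordless {T : SimpleGraph N} (hT : T.IsAcyclic)
    {A : V → T.Subgraph} (hA : ∀ x, (A x).Connected)
    (hadj : ∀ x y, G.Adj x y → ((A x).verts ∩ (A y).verts).Nonempty) {v : V} {c : G.Walk v v}
    (hc : c.IsCycle) (h4 : 4 ≤ c.length)
    (hch : ∀ x ∈ c.support, ∀ y ∈ c.support, G.Adj x y → s(x, y) ∈ c.edges) :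
    ∃ x ∈ c.support, ∃ y ∈ c.support, x ≠ y ∧ ¬ G.Adj x y ∧
      ((A x).verts ∩ (A y).verts).Nonempty := by
  have hinj : ∀ {a b : ℕ}, a < b → b < c.length → c.getVert a ≠ c.getVert b := by
    intro a b hab hb h
    have := hc.getVert_injOn' (show a ≤ c.length - 1 by omega) (show b ≤ c.length - 1 by omega) h
    omega
  have hsucc : ∀ i, i < c.length →
      ((A (c.getVert i)).verts ∩ (A (c.getVert (i + 1))).verts).Nonempty :=
    fun i hi => hadj _ _ (c.adj_getVert_succ hi)
  have hB : ∀ k, ∃ B : T.Subgraph, 2 + k < c.length → B.Connected ∧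
      ∀ h, h ∈ B.verts ↔ ∃ i, 2 ≤ i ∧ i ≤ 2 + k ∧ h ∈ (A (c.getVert i)).verts := by
    intro k
    induction k with
    | zero =>
      refine ⟨A (c.getVert 2), fun _ =>
        ⟨hA _, fun h => ⟨fun hh => ⟨2, by omega, by omega, hh⟩, ?_⟩⟩⟩
      rintro ⟨i, h1, h2, hh⟩
      obtain rfl : i = 2 := by omega
      exact hh
    | succ k ih =>
      obtain ⟨B, hB⟩ := ih
      refine ⟨B ⊔ A (c.getVert (2 + k + 1)), fun hk => ?_⟩
      obtain ⟨hBc, hBv⟩ := hB (by omega)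
      refine ⟨SimpleGraph.Subgraph.connected_sup hBc.preconnected (hA _).preconnected ?_,
        fun h => ⟨?_, ?_⟩⟩
      · obtain ⟨h, h1, h2⟩ := hsucc (2 + k) (by omega)
        exact ⟨h, (hBv h).mpr ⟨2 + k, by omega, by omega, h1⟩, h2⟩
      · rintro (h1 | h1)
        · obtain ⟨i, hi, hi', hh⟩ := (hBv h).mp h1
          exact ⟨i, hi, by omega, hh⟩
        · exact ⟨2 + k + 1, by omega, by omega, h1⟩
      · rintro ⟨i, hi, hi', hh⟩
        by_cases hik : i ≤ 2 + k
        · exact Or.inl ((hBv h).mpr ⟨i, hi, hik, hh⟩)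
        · obtain rfl : i = 2 + k + 1 := by omega
          exact Or.inr hh
  obtain ⟨B, hB⟩ := hB (c.length - 4)
  obtain ⟨hBc, hBv⟩ := hB (by omega)
  have hlast := hsucc (c.length - 1) (by omega)
  rw [show c.length - 1 + 1 = c.length by omega,
    show c.getVert c.length = c.getVert 0 by simp] at hlast
  have hCB : ((A (c.getVert 1)).verts ∩ B.verts).Nonempty := by
    obtain ⟨h, h1, h2⟩ := hsucc 1 (by omega)
    exact ⟨h, h1, (hBv h).mpr ⟨2, by omega, by omega, h2⟩⟩
  have hBD : (B.verts ∩ (A (c.getVert (c.length - 1))).verts).Nonempty := by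
    obtain ⟨h, h1, h2⟩ := hsucc (c.length - 2) (by omega)
    rw [show c.length - 2 + 1 = c.length - 1 by omega] at h2
    exact ⟨h, (hBv h).mpr ⟨c.length - 2, by omega, by omega, h1⟩, h2⟩
  rcases not_four_cycle hT (hA (c.getVert 0)) hBc (hA (c.getVert 1)) (hA (c.getVert (c.length - 1)))
    (hsucc 0 (by omega)) hCB hBD hlast with h | h
  · obtain ⟨h, h0, h1⟩ := h
    obtain ⟨i, hi, hi', hh⟩ := (hBv h).mp h1
    refine ⟨_, c.getVert_mem_support 0, _, c.getVert_mem_support i, hinj (by omega) (by omega),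
      fun hab => ?_, ⟨h, h0, hh⟩⟩
    have := index_of_adj_of_chordless hc hch (show 0 < i by omega) (by omega) hab
    omega
  · refine ⟨_, c.getVert_mem_support 1, _, c.getVert_mem_support (c.length - 1),
      hinj (by omega) (by omega), fun hab => ?_, h⟩
    have := index_of_adj_of_chordless hc hch (show 1 < c.length - 1 by omega) (by omega) hab
    omega

lemma connected_comap_hom {B M : H.Subgraph} (hB : B.Connected) (hBM : B ≤ M) :
    (B.comap M.hom).Connected := by
  obtain ⟨h, hh⟩ := hB.nonempty
  rw [connected_iff_reachable]
  refine ⟨⟨⟨h, hBM.1 hh⟩, hh⟩, fun a ha b hb => reachable_comap ?_⟩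
  rw [inf_eq_left.mpr hBM]
  exact reachable_of_connected hB ha hb

/-- Vertices `a`, `b` of the ball that are both adjacent to a vertex `x` at distance exactly `r / 2`
from the centre have co-parts that meet: the union of the co-parts of all vertices that are nearer
to the centre than `a` and `b` avoids the co-part of `x`, so that otherwise there would be a cycle
of length four of subtrees. -/
lemma inter_nonempty_of_adj_boundary (hr : 3 ≤ r)
    (hD : IsGraphDecompositionIntoCliques G H bag K) {v : V}
    (hT : (localModel G K r v).coe.IsAcyclic)
    (hA : ∀ x, (localCopart G K r v x).Connected)
    {x a b : (ball G r v).verts} (hx : ¬ 2 * G.edist v x < r) (hxa : (ball G r v).Adj x a)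
    (hxb : (ball G r v).Adj x b)
    (hmeet : ∀ y z : (ball G r v).verts, (ball G r v).coe.Adj y z →
      ((localCopart G K r v y).verts ∩ (localCopart G K r v z).verts).Nonempty) :
    ((localCopart G K r v a).verts ∩ (localCopart G K r v b).verts).Nonempty := by
  have hR := hD.isRegionRepresentation
  obtain ⟨m, hm⟩ : ∃ m : ℕ, G.edist v x = (m + 1 + 1 : ℕ) := by
    obtain ⟨d, hd⟩ := ENat.ne_top_iff_exists.mp (edist_ne_top_of_two_mul_le x.2)
    rw [← hd] at hx ⊢
    norm_cast at hx
    exact ⟨d - 2, by congr 1; omega⟩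
  have hxr : 2 * (m + 1 + 1) ≤ r := by
    have : 2 * G.edist v x ≤ r := x.2
    rw [hm] at this
    exact_mod_cast this
  have hnbr : ∀ y : (ball G r v).verts, (ball G r v).Adj x y →
      ∃ h : (localModel G K r v).verts, (h : N) ∈ (K y).verts ∧
        ∃ z, G.edist v z ≤ m ∧ (h : N) ∈ (K z).verts := by
    intro y hy
    have hym : G.edist v y = (m + 1 : ℕ) := by
      have h1 := hy.2
      have h2 : G.edist v x ≤ G.edist v y + G.edist y x := SimpleGraph.edist_triangle
      rw [SimpleGraph.edist_eq_one_iff_adj.mpr hy.1.symm] at h2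
      have hyt := edist_ne_top_of_two_mul_le y.2
      rw [hm] at hx h1 h2
      generalize G.edist v y = d at *
      lift d to ℕ using hyt
      norm_cast at *
      omega
    obtain ⟨z, hzy, hz⟩ := exists_adj_edist_eq hym
    obtain ⟨h, hhz, hhy⟩ := (hR.adj_iff z y hzy.ne).mp hzy
    refine ⟨⟨h, (le_localModel (x := z) ?_).1 hhz⟩, hhy, z, hz.le, hhz⟩
    rw [hz]; norm_cast; omega
  let B : H.Subgraph := ⨆ z ∈ {z | G.edist v z ≤ m}, K z
  have hBv : ∀ h, h ∈ B.verts ↔ ∃ z, G.edist v z ≤ m ∧ h ∈ (K z).verts := by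
    intro h; simp [B]
  have hKB : ∀ z, G.edist v z ≤ m → K z ≤ B := fun z hz =>
    le_iSup₂_of_le (f := fun z (_ : z ∈ {z | G.edist v z ≤ m}) => K z) z hz le_rfl
  have hBM : B ≤ localModel G K r v := iSup₂_le fun z hz => le_localModel (by
    refine (mul_le_mul_right (show G.edist v z ≤ m from hz) 2).trans_lt ?_
    norm_cast; omega)
  have hBc : B.Connected := by
    obtain ⟨h₀, hh₀⟩ := (hR.region v).nonempty
    have key : ∀ h ∈ B.verts, B.spanningCoe.Reachable h₀ h := by
      intro h hh
      obtain ⟨z, hz, hhz⟩ := (hBv h).mp hh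
      exact hR.reachable_of_edist_le hKB hz hh₀ hhz
    rw [connected_iff_reachable]
    refine ⟨⟨h₀, (hBv h₀).mpr ⟨v, by simp, hh₀⟩⟩, fun y hy z hz => (key y hy).symm.trans (key z hz)⟩
  have hB' := connected_comap_hom hBc hBM
  have hCB : ((localCopart G K r v a).verts ∩
      (B.comap (localModel G K r v).hom).verts).Nonempty := by
    obtain ⟨h, hha, hz⟩ := hnbr a hxa
    exact ⟨h, hha, (hBv h).mpr hz⟩
  have hBD : ((B.comap (localModel G K r v).hom).verts ∩
      (localCopart G K r v b).verts).Nonempty := by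
    obtain ⟨h, hhb, hz⟩ := hnbr b hxb
    exact ⟨h, (hBv h).mpr hz, hhb⟩
  rcases not_four_cycle hT (hA x) hB' (hA a) (hA b) (hmeet _ _ hxa) hCB hBD (hmeet _ _ hxb.symm)
    with h | h
  · obtain ⟨h, hhx, hhB⟩ := h
    obtain ⟨z, hz, hhz⟩ := (hBv h).mp hhB
    have hzx : G.edist z x ≤ 1 := by
      rw [SimpleGraph.edist_le_one_iff_adj_or_eq]
      by_cases heq : z = x
      · exact Or.inr heq
      · exact Or.inl ((hR.adj_iff z x heq).mpr ⟨h, hhz, hhx⟩)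
    have h2 : G.edist v x ≤ m + 1 :=
      (SimpleGraph.edist_triangle (v := z)).trans (add_le_add hz hzx)
    rw [hm] at h2
    norm_cast at h2
    omega
  · exact h

/-- A graph with a decomposition into cliques that locally induces tree-decompositions is locally
chordal. -/
theorem LocallyInducesTreeDecompositions.isLocallyChordal (hr : 3 ≤ r)
    (hD : IsGraphDecompositionIntoCliques G H bag K)
    (hL : LocallyInducesTreeDecompositions G bag K r) : IsLocallyChordal G r := by
  classical
  intro v w c hc h4
  obtain ⟨hT, hdec, hcop⟩ := hL v
  have hmeet : ∀ y z : (ball G r v).verts, (ball G r v).coe.Adj y z →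
      ((localCopart G K r v y).verts ∩ (localCopart G K r v z).verts).Nonempty := by
    intro y z hyz
    have h1 : (⨆ h, (⊤ : (ball G r v).coe.Subgraph).induce (localBag G bag K r v h)).Adj y z := by
      rw [hdec.union_parts]; exact hyz
    rw [SimpleGraph.Subgraph.iSup_adj] at h1
    obtain ⟨h, hy, hz, _⟩ := h1
    exact ⟨h, hcop.mem_verts_iff.mpr hy, hcop.mem_verts_iff.mpr hz⟩
  have hadj : ∀ y z : (ball G r v).verts, y ≠ z → G.edist v y + G.edist v z < r →
      ((localCopart G K r v y).verts ∩ (localCopart G K r v z).verts).Nonempty →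
      (ball G r v).coe.Adj y z := by
    rintro y z hyz hlt ⟨h, hy, hz⟩
    exact ⟨(hD.isRegionRepresentation.adj_iff y z (fun h => hyz (Subtype.ext h))).mpr
      ⟨h, hy, hz⟩, hlt⟩
  by_contra hcon
  have hch : ∀ x ∈ c.support, ∀ y ∈ c.support, (ball G r v).coe.Adj x y → s(x, y) ∈ c.edges := by
    intro x hx y hy hxy
    by_contra hne
    exact hcon ⟨x, hx, y, hy, hxy, hne⟩
  by_cases hin : ∀ x ∈ c.support, 2 * G.edist v x < r
  · obtain ⟨x, hx, y, hy, hxy, hnadj, hne⟩ :=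
      exists_inter_nonempty_of_chordless hT.isAcyclic hcop.connected hmeet hc h4 hch
    exact hnadj (hadj x y hxy (edist_add_lt (hin x hx).le (hin y hy)) hne)
  · -- the neighbours on the cycle of a vertex at distance `r / 2` would be adjacent
    push Not at hin
    obtain ⟨x, hx, hxr⟩ := hin
    have hc' := hc.rotate hx
    have hlen : (c.rotate x hx).length = c.length := SimpleGraph.Walk.length_rotate ..
    have hch' : ∀ y ∈ (c.rotate x hx).support, ∀ z ∈ (c.rotate x hx).support,
        (ball G r v).coe.Adj y z → s(y, z) ∈ (c.rotate x hx).edges := by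
      intro y hy z hz hyz
      rw [SimpleGraph.Walk.mem_support_rotate_iff] at hy hz
      rw [(SimpleGraph.Walk.rotate_edges c x hx).mem_iff]
      exact hch y hy z hz hyz
    generalize c.rotate x hx = c' at *
    have hxa := c'.adj_getVert_succ (i := 0) (by omega)
    have hbx := c'.adj_getVert_succ (i := c'.length - 1) (by omega)
    rw [SimpleGraph.Walk.getVert_zero] at hxa
    rw [show c'.length - 1 + 1 = c'.length by omega, SimpleGraph.Walk.getVert_length] at hbx
    have hint : ∀ y : (ball G r v).verts, (ball G r v).Adj x y → 2 * G.edist v y < r := by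
      intro y hy
      have h1 := hy.2
      have h2 := edist_ne_top_of_two_mul_le x.2
      have h3 := edist_ne_top_of_two_mul_le y.2
      generalize G.edist v x = a at *
      generalize G.edist v y = b at *
      lift a to ℕ using h2
      lift b to ℕ using h3
      norm_cast at *
      omega
    have hne := inter_nonempty_of_adj_boundary hr hD hT.isAcyclic hcop.connected
      (not_lt.mpr hxr) hxa hbx.symm hmeet
    have hab := hadj _ _ (fun h => ?_) (edist_add_lt (hint _ hxa).le (hint _ hbx.symm)) hne
    · have := index_of_adj_of_chordless hc' hch' (show 0 + 1 < c'.length - 1 by omega)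
        (by omega) hab
      omega
    · have := hc'.getVert_injOn' (show 0 + 1 ≤ c'.length - 1 by omega)
        (show c'.length - 1 ≤ c'.length - 1 by omega) h
      omega

end Balls

/-! ### Local separations -/

section Separations

variable {G : SimpleGraph V} {H : SimpleGraph N} {bag : N → Set V} {K : V → H.Subgraph} {r : ℕ}
  {h₀ h₁ : N}

lemma IsCut.eq_of_mem_sideNodes {v : V} {q : N → ZMod 2} (hq : IsCut (K v) s(h₀, h₁) q) {h : N}
    (hh : h ∈ sideNodes K h₀ h₁ v) : q h₀ = q h :=
  hq.eq_of_reachable (fun _ _ hab => hab) hh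

lemma IsCut.eq_of_not_adj {L : H.Subgraph} {q : N → ZMod 2} (hq : IsCut L s(h₀, h₁) q)
    (hL : L.Connected) (hadj : ¬ L.Adj h₀ h₁) {a b : N} (ha : a ∈ L.verts) (hb : b ∈ L.verts) :
    q a = q b := by
  refine hq.eq_of_reachable (fun x y hxy => ⟨hxy, fun he => hadj ?_⟩)
    (reachable_of_connected hL ha hb)
  rcases Sym2.eq_iff.mp he with ⟨rfl, rfl⟩ | ⟨rfl, rfl⟩
  · exact hxy
  · exact hxy.symm

/-- The nodes of a co-part lie on the sides of `h₀` and `h₁`. -/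
lemma mem_sideNodes_or {v : V} (hv : (K v).Connected) (h₀v : h₀ ∈ (K v).verts) {h : N}
    (hh : h ∈ (K v).verts) : h ∈ sideNodes K h₀ h₁ v ∨ h ∈ sideNodes K h₁ h₀ v := by
  have key : ∀ {a b : N} (p : (K v).spanningCoe.Walk a b),
      ((K v).deleteEdges {s(h₀, h₁)}).spanningCoe.Reachable a b ∨
        ((K v).deleteEdges {s(h₀, h₁)}).spanningCoe.Reachable h₀ b ∨
        ((K v).deleteEdges {s(h₀, h₁)}).spanningCoe.Reachable h₁ b := by
    intro a b p
    induction p with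
    | nil => exact Or.inl .rfl
    | @cons a z b hadj p ih =>
      by_cases he : s(a, z) = s(h₀, h₁)
      · rcases Sym2.eq_iff.mp he with ⟨rfl, rfl⟩ | ⟨rfl, rfl⟩
        · rcases ih with ih | ih | ih
          · exact Or.inr (Or.inr ih)
          · exact Or.inl ih
          · exact Or.inr (Or.inr ih)
        · rcases ih with ih | ih | ih
          · exact Or.inr (Or.inl ih)
          · exact Or.inr (Or.inl ih)
          · exact Or.inl ih
      · rcases ih with ih | ih
        · exact Or.inl (SimpleGraph.Reachable.trans (SimpleGraph.Adj.reachable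
            (show ((K v).deleteEdges {s(h₀, h₁)}).Adj a z from ⟨hadj, he⟩)) ih)
        · exact Or.inr ih
  obtain ⟨p⟩ := reachable_of_connected hv h₀v hh
  change _ ∨ ((K v).deleteEdges {s(h₁, h₀)}).spanningCoe.Reachable h₁ h
  rw [Sym2.eq_swap (a := h₁)]
  rcases key p with h | h | h
  · exact Or.inl h
  · exact Or.inl h
  · exact Or.inr h

lemma exists_sideNode_of_mem_sideEdges {v w : V} (hv : v ∈ adhesion bag h₀ h₁)
    (h : s(v, w) ∈ sideEdges G bag K h₀ h₁) :
    ∃ h ∈ sideNodes K h₀ h₁ v, w ∈ bag h := by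
  obtain ⟨v', hv', w', hw', _, heq, h, hh, hwh⟩ := h
  rcases Sym2.eq_iff.mp heq with ⟨rfl, rfl⟩ | ⟨rfl, rfl⟩
  · exact ⟨h, hh, hwh⟩
  · exact absurd hv hw'

lemma adhesion_comm : adhesion bag h₁ h₀ = adhesion bag h₀ h₁ := Set.inter_comm _ _

/-- An `r`-acyclic decomposition into cliques with induced co-parts induces `r`-local separations.
If an `X`-walk inside a short cycle left the adhesion set `X` on one side of the edge `h₀h₁` and
returned on the other side, then `h₀h₁` would not be a bridge of the union of the co-parts of the
vertices of this cycle. -/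
theorem IsGraphDecompositionIntoCliques.inducesLocalSeparations (hr : 2 ≤ r)
    (hD : IsGraphDecompositionIntoCliques G H bag K) (hA : IsRAcyclic r K)
    (hK : ∀ v, K v = (⊤ : H.Subgraph).induce (cobag bag v)) :
    InducesLocalSeparations G H bag K r := by
  have hR := hD.isRegionRepresentation
  refine ⟨fun v => ⟨(hR.region v).coe, hA.isAcyclic (by omega) v⟩, fun u v _ => ?_,
    fun u v huv => hR.connected_inf hr hA huv, fun h₀ h₁ hadj => ?_⟩
  · rw [hK u, hK v]
    apply SimpleGraph.Subgraph.ext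
    · rfl
    · ext a b
      constructor
      · rintro ⟨⟨h1, h2, h3⟩, ⟨h4, h5, _⟩⟩
        exact ⟨⟨h1, h4⟩, ⟨h2, h5⟩, h3⟩
      · rintro ⟨⟨h1, h4⟩, ⟨h2, h5⟩, h3⟩
        exact ⟨⟨h1, h2, h3⟩, ⟨h4, h5, h3⟩⟩
  · have hX : ∀ x, x ∈ adhesion bag h₀ h₁ → (K x).Adj h₀ h₁ := by
      rintro x ⟨hx0, hx1⟩
      rw [hK x]
      exact ⟨hx0, hx1, hadj⟩
    have hX' : ∀ x, x ∉ adhesion bag h₀ h₁ → ¬ (K x).Adj h₀ h₁ := fun x hx h =>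
      hx ⟨hD.coparts.mem_verts_iff.mp ((K x).edge_vert h),
        hD.coparts.mem_verts_iff.mp ((K x).edge_vert h.symm)⟩
    have hcontr : ∀ {q : N → ZMod 2} {v : V}, v ∈ adhesion bag h₀ h₁ →
        IsCut (K v) s(h₀, h₁) q → q h₀ ≠ q h₁ := by
      intro q v hv hq heq
      have := hq h₀ h₁ (hX v hv)
      rw [if_pos rfl, heq, zmod_two_add_self] at this
      exact zero_ne_one this
    refine ⟨⟨?_, ?_⟩, ?_⟩
    · rw [Set.disjoint_left]
      rintro e ⟨v, hv, w, hw, hvw, rfl, h, hh, hwh⟩ he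
      rw [← adhesion_comm] at hv hw
      obtain ⟨h', hh', hwh'⟩ := exists_sideNode_of_mem_sideEdges hv he
      rw [adhesion_comm] at hv hw
      obtain ⟨q, hq⟩ := hA.exists_isCut (Z := {v, w}) ((Set.encard_insert_le _ _).trans (by
        rw [Set.encard_singleton, one_add_one_eq_two]; exact_mod_cast hr)) s(h₀, h₁)
      have hqv := hq v (by simp)
      refine hcontr hv hqv ?_
      rw [hqv.eq_of_mem_sideNodes hh, (Sym2.eq_swap ▸ hqv :
        IsCut (K v) s(h₁, h₀) q).eq_of_mem_sideNodes hh']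
      exact (hq w (by simp)).eq_of_not_adj (hR.region w) (hX' w hw)
        (hD.coparts.mem_verts_iff.mpr hwh) (hD.coparts.mem_verts_iff.mpr hwh')
    · ext e
      constructor
      · rintro (⟨v, hv, w, hw, hvw, rfl, _⟩ | ⟨v, hv, w, hw, hvw, rfl, _⟩)
        · exact ⟨v, hv, w, hw, hvw, rfl⟩
        · rw [adhesion_comm] at hv hw
          exact ⟨v, hv, w, hw, hvw, rfl⟩
      · rintro ⟨v, hv, w, hw, hvw, rfl⟩
        obtain ⟨h, hhv, hhw⟩ := (hR.adj_iff v w hvw.ne).mp hvw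
        have hwh := hD.coparts.mem_verts_iff.mp hhw
        rcases mem_sideNodes_or (hR.region v) ((K v).edge_vert (hX v hv)) hhv (h₁ := h₁)
          with hs | hs
        · exact Or.inl ⟨v, hv, w, hw, hvw, rfl, h, hs, hwh⟩
        · exact Or.inr ⟨v, by rwa [adhesion_comm], w, by rwa [adhesion_comm], hvw, rfl, h, hs, hwh⟩
    · rintro a b p ⟨⟨ha, hb, hint⟩, hloc⟩ ⟨⟨e, hep, he⟩, e', hep', he'⟩
      have hidx : ∀ w ∈ p.support, w ∉ adhesion bag h₀ h₁ →
          ∃ i, 0 < i ∧ i < p.length ∧ p.getVert i = w := by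
        intro w hw hwX
        obtain ⟨i, rfl, hi⟩ := SimpleGraph.Walk.mem_support_iff_exists_getVert.mp hw
        refine ⟨i, Nat.pos_of_ne_zero ?_, lt_of_le_of_ne hi ?_, rfl⟩
        · rintro rfl
          exact hwX (by rwa [p.getVert_zero])
        · rintro rfl
          exact hwX (by rwa [p.getVert_length])
      rcases hloc with ⟨z, c, hc, hcr, hpc⟩ | h1
      · have hsupp : ∀ x ∈ p.support, x ∈ c.support := fun x hx =>
          (c.mem_verts_toSubgraph).mp (hpc.1 ((p.mem_verts_toSubgraph).mpr hx))
        obtain ⟨q, hq⟩ := hA.exists_isCut (Z := {x | x ∈ c.support})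
          ((encard_support_le c (by have := hc.three_le_length; omega)).trans
            (by exact_mod_cast hcr)) s(h₀, h₁)
        have hconst : ∀ i, 0 < i → i < p.length → ∀ h ∈ (K (p.getVert i)).verts,
            ∀ h' ∈ (K (p.getVert 1)).verts, q h = q h' := by
          intro i hi0
          induction i, hi0 using Nat.le_induction with
          | base =>
            intro hi h hh h' hh'
            exact (hq _ (hsupp _ (p.getVert_mem_support _))).eq_of_not_adj (hR.region _)
              (hX' _ (hint 1 (by omega) hi)) hh hh'
          | succ i hi ih =>
            intro hi' h hh h' hh'
            have hadj' := p.adj_getVert_succ (i := i) (by omega)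
            obtain ⟨g, hg, hg'⟩ := (hR.adj_iff _ _ hadj'.ne).mp hadj'
            rw [← ih (by omega) g hg h' hh']
            exact (hq _ (hsupp _ (p.getVert_mem_support _))).eq_of_not_adj (hR.region _)
              (hX' _ (hint (i + 1) (by omega) hi')) hh hg'
        obtain ⟨g, hg⟩ := (hR.region (p.getVert 1)).nonempty
        -- both ends of the edge `h₀h₁` have the same value as the nodes of the internal vertices
        obtain ⟨v, hv, w, hw, hvw, rfl, h, hh, hwh⟩ := he
        obtain ⟨v', hv', w', hw', hvw', rfl, h', hh', hwh'⟩ := he'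
        rw [adhesion_comm] at hv' hw'
        obtain ⟨i, hi0, hi, rfl⟩ := hidx w (p.snd_mem_support_of_mem_edges hep) hw
        obtain ⟨j, hj0, hj, rfl⟩ := hidx w' (p.snd_mem_support_of_mem_edges hep') hw'
        have hqv := hq v (hsupp v (p.fst_mem_support_of_mem_edges hep))
        have hqv' := hq v' (hsupp v' (p.fst_mem_support_of_mem_edges hep'))
        refine hcontr hv hqv ?_
        rw [hqv.eq_of_mem_sideNodes hh, (Sym2.eq_swap ▸ hqv' :
          IsCut (K v') s(h₁, h₀) q).eq_of_mem_sideNodes hh',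
          hconst i hi0 hi h (hD.coparts.mem_verts_iff.mpr hwh) g hg,
          hconst j hj0 hj h' (hD.coparts.mem_verts_iff.mpr hwh') g hg]
      · obtain ⟨v, hv, w, hw, hvw, rfl, _⟩ := he
        obtain ⟨i, hi0, hi, _⟩ := hidx w (p.snd_mem_support_of_mem_edges hep) hw
        omega

/-- A cycle of length at most `r` traverses an even number of edges of the side `E₁` of an `r`-local
separation, since each of its segments between consecutive visits to `X` leaves and enters `X` on
the same side. -/
lemma IsLocalSeparation.walkSum_eq_zero {E₀ E₁ : Set (Sym2 V)} {X : Set V}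
    (hS : IsLocalSeparation G r E₀ X E₁) {φ : V → V → ZMod 2}
    (hin : ∀ x ∈ X, ∀ y ∈ X, G.Adj x y → φ x y = 0)
    (hout : ∀ x ∉ X, ∀ y ∉ X, G.Adj x y → φ x y = 0)
    (hφ₀ : ∀ x y, G.Adj x y → s(x, y) ∈ E₀ → φ x y = 0)
    (hφ₁ : ∀ x y, G.Adj x y → s(x, y) ∈ E₁ → φ x y = 1) {z : V} (c : G.Walk z z)
    (hc : c.IsCycle) (hr : c.length ≤ r) : walkSum φ c = 0 := by
  classical
  have key : ∀ {a b : V} (w : G.Walk a b), b ∈ X → w.toSubgraph ≤ c.toSubgraph →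
      (a ∈ X → walkSum φ w = 0) ∧
      (a ∉ X → ∀ x ∈ X, ∀ p : G.Walk x a, p.toSubgraph ≤ c.toSubgraph →
        (∀ i, 0 < i → i ≤ p.length → p.getVert i ∉ X) →
        (∃ y ∉ X, G.Adj x y ∧ s(x, y) ∈ p.edges ∧ walkSum φ p = φ x y) →
        walkSum φ p + walkSum φ w = 0) := by
    intro a b w
    induction w with
    | nil => exact fun hb _ => ⟨fun _ => rfl, fun ha => absurd hb ha⟩
    | @cons a z b h w ih =>
      intro hb hw
      have hw' : w.toSubgraph ≤ c.toSubgraph := le_sup_right.trans hw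
      have hh : (h.toWalk).toSubgraph ≤ c.toSubgraph := by
        rw [SimpleGraph.Adj.toSubgraph_toWalk]
        exact le_sup_left.trans hw
      obtain ⟨ih1, ih2⟩ := ih hb hw'
      constructor
      · intro ha
        by_cases hz : z ∈ X
        · rw [walkSum_cons, hin a ha z hz h, ih1 hz, add_zero]
        · have := ih2 hz a ha h.toWalk hh (fun i hi hi' => by
            have : i = 1 := by simp at hi'; omega
            subst this; simpa using hz) ⟨z, hz, h, by simp, by simp⟩
          simpa using this
      · rintro ha x hx p hp hpX ⟨y, hy, hxy, hyp, hsum⟩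
        have hp' : (p.append h.toWalk).toSubgraph ≤ c.toSubgraph := by
          rw [SimpleGraph.Walk.toSubgraph_append]
          exact sup_le hp hh
        have hvert : ∀ i, i ≤ p.length → (p.append h.toWalk).getVert i = p.getVert i := by
          intro i hi
          rw [SimpleGraph.Walk.getVert_append]
          split_ifs with h1
          · rfl
          · obtain rfl : i = p.length := by omega
            simp
        have hlen : (p.append h.toWalk).length = p.length + 1 := by simp
        by_cases hz : z ∈ X
        · have hloc : IsLocalXWalk r X (p.append h.toWalk) :=
            ⟨⟨hx, hz, fun i hi hi' => by
              rw [hvert i (by omega)]; exact hpX i hi (by omega)⟩, Or.inl ⟨_, c, hc, hr, hp'⟩⟩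
          have hnot := hS.2 _ _ _ hloc
          have h1 : s(x, y) ∈ E₀ ∪ E₁ := by
            rw [hS.1.2]; exact ⟨x, hx, y, hy, hxy, rfl⟩
          have h2 : s(a, z) ∈ E₀ ∪ E₁ := by
            rw [hS.1.2]; exact ⟨z, hz, a, ha, h.symm, Sym2.eq_swap⟩
          have hm1 : s(x, y) ∈ (p.append h.toWalk).edges := by simp [hyp]
          have hm2 : s(a, z) ∈ (p.append h.toWalk).edges := by simp
          rw [walkSum_cons, ih1 hz, hsum, add_zero]
          rcases h1 with h1 | h1 <;> rcases h2 with h2 | h2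
          · rw [hφ₀ x y hxy h1, hφ₀ a z h h2, add_zero]
          · exact absurd ⟨⟨_, hm1, h1⟩, _, hm2, h2⟩ hnot
          · exact absurd ⟨⟨_, hm2, h2⟩, _, hm1, h1⟩ hnot
          · rw [hφ₁ x y hxy h1, hφ₁ a z h h2, zmod_two_add_self]
        · have hφ : φ a z = 0 := hout a ha z hz h
          have := ih2 hz x hx (p.append h.toWalk) hp' (fun i hi hi' => by
            by_cases hip : i ≤ p.length
            · rw [hvert i hip]; exact hpX i hi hip
            · rw [(p.append h.toWalk).getVert_of_length_le (by omega)]; exact hz)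
            ⟨y, hy, hxy, by simp [hyp], by simp [hsum, hφ]⟩
          rw [walkSum_cons, hφ, zero_add, ← this, walkSum_append]
          simp [hφ]
  by_cases hX : ∃ x ∈ c.support, x ∈ X
  · obtain ⟨x, hx, hxX⟩ := hX
    rw [← walkSum_rotate φ c hx]
    refine (key (c.rotate x hx) hxX ?_).1 hxX
    rw [SimpleGraph.Walk.toSubgraph_rotate]
  · push Not at hX
    rw [walkSum_of_potential (p := fun _ => 0) c fun x hx y hy hxy => by
      rw [hout x (hX x hx) y (hX y hy) hxy, add_zero], add_zero]

lemma walkSum_map {V' : Type*} {G' : SimpleGraph V'} (f : G' →g G) (φ : V → V → ZMod 2)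
    {a b : V'} (p : G'.Walk a b) :
    walkSum φ (p.map f) = walkSum (fun x y => φ (f x) (f y)) p := by
  induction p with
  | nil => rfl
  | cons h p ih => rw [SimpleGraph.Walk.map_cons, walkSum_cons, walkSum_cons, ih]

/-- A decomposition into cliques that induces `r`-local separations is `r`-acyclic: the cocycle that
belongs to an edge `h₀h₁` of the model graph is the indicator function of the side of `h₁` of the
local separation that `h₀h₁` induces. -/
theorem InducesLocalSeparations.isRAcyclic (hD : IsGraphDecompositionIntoCliques G H bag K)
    (hS : InducesLocalSeparations G H bag K r) : IsRAcyclic r K := by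
  classical
  intro Z hZ
  rw [isAcyclic_biSup_coe_iff]
  intro e
  have hR := hD.isRegionRepresentation
  by_cases he : ∃ z, e ∈ (K z).edgeSet
  swap
  · refine ⟨0, fun x _ a b hab => ?_⟩
    rw [if_neg (by rintro rfl; exact he ⟨x, hab⟩)]; simp
  obtain ⟨z, hz⟩ := he
  induction e with | _ h₀ h₁ =>
  have hz : (K z).Adj h₀ h₁ := hz
  have hzX : z ∈ adhesion bag h₀ h₁ := ⟨hD.coparts.mem_verts_iff.mp ((K z).edge_vert hz),
    hD.coparts.mem_verts_iff.mp ((K z).edge_vert hz.symm)⟩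
  have hX : ∀ x, x ∈ adhesion bag h₀ h₁ → (K x).Adj h₀ h₁ := by
    rintro x ⟨hx0, hx1⟩
    by_cases hxz : x = z
    · rw [hxz]; exact hz
    · have hadj : (K x ⊓ K z).Adj h₀ h₁ := by
        rw [hS.inter_eq x z (hD.cliques h₀ hx0 hzX.1 hxz)]
        exact ⟨⟨hx0, hzX.1⟩, ⟨hx1, hzX.2⟩, hz.adj_sub⟩
      exact hadj.1
  have hX' : ∀ x a b, (K x).Adj a b → s(a, b) = s(h₀, h₁) → x ∈ adhesion bag h₀ h₁ := by
    intro x a b hab heq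
    have ha := hD.coparts.mem_verts_iff.mp ((K x).edge_vert hab)
    have hb := hD.coparts.mem_verts_iff.mp ((K x).edge_vert hab.symm)
    rcases Sym2.eq_iff.mp heq with ⟨rfl, rfl⟩ | ⟨rfl, rfl⟩
    · exact ⟨ha, hb⟩
    · exact ⟨hb, ha⟩
  have hh₀ : ∀ x, h₀ ∈ sideNodes K h₀ h₁ x := fun x => SimpleGraph.Reachable.rfl
  have hh₁ : ∀ x ∈ adhesion bag h₀ h₁, h₁ ∉ sideNodes K h₀ h₁ x := by
    intro x hx hside
    obtain ⟨q, hq⟩ := isAcyclic_coe_iff.mp (hS.copart_isTree x).isAcyclic s(h₀, h₁)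
    have h1 := hq h₀ h₁ (hX x hx)
    rw [if_pos rfl, hq.eq_of_mem_sideNodes hside, zmod_two_add_self] at h1
    exact zero_ne_one h1
  let s : V → N → ZMod 2 := fun x h =>
    if x ∈ adhesion bag h₀ h₁ ∧ h ∉ sideNodes K h₀ h₁ x then 1 else 0
  have hs : ∀ x, IsCut (K x) s(h₀, h₁) (s x) := by
    intro x a b hab
    by_cases hx : x ∈ adhesion bag h₀ h₁
    · by_cases heq : s(a, b) = s(h₀, h₁)
      · rw [if_pos heq]
        rcases Sym2.eq_iff.mp heq with ⟨rfl, rfl⟩ | ⟨rfl, rfl⟩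
        · simp [s, hx, hh₀ x, hh₁ x hx]
        · simp [s, hx, hh₀ x, hh₁ x hx]
      · rw [if_neg heq]
        have hdel : ((K x).deleteEdges {s(h₀, h₁)}).spanningCoe.Adj a b := ⟨hab, heq⟩
        have hiff : a ∈ sideNodes K h₀ h₁ x ↔ b ∈ sideNodes K h₀ h₁ x :=
          ⟨fun h => h.trans hdel.reachable, fun h => h.trans hdel.symm.reachable⟩
        simp only [s, hiff, zmod_two_add_self]
    · rw [if_neg fun heq => hx (hX' x a b hab heq)]
      simp [s, hx]
  have hdiff : ∀ x y, ∃ a : ZMod 2, G.Adj x y → ∀ h ∈ (K x).verts, h ∈ (K y).verts →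
      s x h + s y h = a := by
    intro x y
    by_cases hxy : G.Adj x y
    · have hc := hS.inter_connected x y hxy
      obtain ⟨g, hg⟩ := hc.nonempty
      exact ⟨s x g + s y g, fun _ h hx hy => ((hs x).mono inf_le_left).add_eq_add
        ((hs y).mono inf_le_right) (reachable_of_connected hc ⟨hx, hy⟩ hg)⟩
    · exact ⟨0, fun h => absurd h hxy⟩
  choose φ hφ using hdiff
  have hsymm : ∀ x y, G.Adj x y → φ x y = φ y x := by
    intro x y hxy
    obtain ⟨h, hx, hy⟩ := (hR.adj_iff x y hxy.ne).mp hxy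
    rw [← hφ x y hxy h hx hy, ← hφ y x hxy.symm h hy hx, add_comm]
  have hsep := hS.edge_induces h₀ h₁ hz.adj_sub
  have hside₀ : ∀ x y, G.Adj x y → x ∈ adhesion bag h₀ h₁ → y ∉ adhesion bag h₀ h₁ →
      s(x, y) ∈ sideEdges G bag K h₀ h₁ → φ x y = 0 := by
    intro x y hxy hx hy h
    obtain ⟨h, hh, hyh⟩ := exists_sideNode_of_mem_sideEdges hx h
    have hhy := hD.coparts.mem_verts_iff.mpr hyh
    have hhx : h ∈ (K x).verts := by
      by_cases heq : h₀ = h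
      · exact heq ▸ (K x).edge_vert (hX x hx)
      · obtain ⟨p⟩ := hh
        exact mem_verts_of_mem_support p ((K x).edge_vert (hX x hx)) p.end_mem_support
    rw [← hφ x y hxy h hhx hhy]
    simp [s, hy, hh]
  have hside₁ : ∀ x y, G.Adj x y → x ∈ adhesion bag h₀ h₁ → y ∉ adhesion bag h₀ h₁ →
      s(x, y) ∈ sideEdges G bag K h₁ h₀ → φ x y = 1 := by
    intro x y hxy hx hy h
    rw [← adhesion_comm] at hx hy
    obtain ⟨h, hh, hyh⟩ := exists_sideNode_of_mem_sideEdges hx h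
    rw [adhesion_comm] at hx hy
    have hhy := hD.coparts.mem_verts_iff.mpr hyh
    have hhx : h ∈ (K x).verts := by
      obtain ⟨p⟩ := hh
      exact mem_verts_of_mem_support p ((K x).edge_vert (hX x hx).symm) p.end_mem_support
    have hnot : h ∉ sideNodes K h₀ h₁ x := by
      intro h'
      have hh' : ((K x).deleteEdges {s(h₁, h₀)}).spanningCoe.Reachable h₁ h := hh
      rw [Sym2.eq_swap] at hh'
      exact hh₁ x hx (SimpleGraph.Reachable.trans h' hh'.symm)
    rw [← hφ x y hxy h hhx hhy]
    simp [s, hx, hy, hnot]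
  have hmixed : ∀ {x y : V}, s(x, y) ∈ edgeBoundary G (adhesion bag h₀ h₁) →
      (x ∈ adhesion bag h₀ h₁ ∧ y ∉ adhesion bag h₀ h₁) ∨
        (y ∈ adhesion bag h₀ h₁ ∧ x ∉ adhesion bag h₀ h₁) := by
    rintro x y ⟨a, ha, b, hb, _, heq⟩
    rcases Sym2.eq_iff.mp heq with ⟨rfl, rfl⟩ | ⟨rfl, rfl⟩
    · exact Or.inl ⟨ha, hb⟩
    · exact Or.inr ⟨ha, hb⟩
  have hcycle : ∀ {z : V} (c : G.Walk z z), c.IsCycle → c.length ≤ r → walkSum φ c = 0 := by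
    refine fun c => hsep.walkSum_eq_zero (fun x hx y hy hxy => ?_) (fun x hx y hy hxy => ?_)
      (fun x y hxy hmem => ?_) (fun x y hxy hmem => ?_) c
    · rw [← hφ x y hxy h₀ ((K x).edge_vert (hX x hx)) ((K y).edge_vert (hX y hy))]
      simp [s, hh₀]
    · obtain ⟨h, hhx, hhy⟩ := (hR.adj_iff x y hxy.ne).mp hxy
      rw [← hφ x y hxy h hhx hhy]
      simp [s, hx, hy]
    · rcases hmixed (hsep.1.2.subset (Or.inl hmem)) with ⟨hx, hy⟩ | ⟨hy, hx⟩
      · exact hside₀ x y hxy hx hy hmem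
      · rw [hsymm x y hxy]
        exact hside₀ y x hxy.symm hy hx (Sym2.eq_swap ▸ hmem)
    · rcases hmixed (hsep.1.2.subset (Or.inr hmem)) with ⟨hx, hy⟩ | ⟨hy, hx⟩
      · exact hside₁ x y hxy hx hy hmem
      · rw [hsymm x y hxy]
        exact hside₁ y x hxy.symm hy hx (Sym2.eq_swap ▸ hmem)
  obtain ⟨p, hp⟩ := exists_potential (G := G.induce Z) (φ := fun x y => φ x y)
    (fun x y hxy => hsymm x y hxy) (fun v c hc => by
      have hmap := hc.map (f := (SimpleGraph.Embedding.induce (G := G) Z).toHom)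
        Subtype.val_injective
      have h0 := hcycle _ hmap (cycle_length_le hmap (fun x hx => by
        rw [SimpleGraph.Walk.support_map, List.mem_map] at hx
        obtain ⟨y, _, rfl⟩ := hx
        exact y.2) hZ)
      rw [walkSum_map] at h0
      exact h0)
  refine exists_isCut_of_potential s (fun x _ => hs x)
    (fun x => if hx : x ∈ Z then p ⟨x, hx⟩ else 0) fun x hx y hy hxy h hhx hhy => ?_
  have hadj : G.Adj x y := (hR.adj_iff x y hxy).mpr ⟨h, hhx, hhy⟩
  rw [dif_pos hx, dif_pos hy, hφ x y hadj h hhx hhy]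
  exact hp ⟨x, hx⟩ ⟨y, hy⟩ hadj

end Separations
end LocChordal

theorem theorem1 {V : Type u} (G : SimpleGraph V) [G.LocallyFinite] (r : ℕ) (hr : 3 ≤ r) :
    List.TFAE [
      LocChordal.IsLocallyChordal G r,
      LocChordal.IsRAcyclicRegionIntersectionGraph G r,
      ∃ (N : Type u) (H : SimpleGraph N) (bag : N → Set V) (K : V → H.Subgraph),
        LocChordal.IsGraphDecompositionIntoCliques G H bag K ∧
          LocChordal.IsRAcyclic r K,
      ∃ (N : Type u) (H : SimpleGraph N) (bag : N → Set V) (K : V → H.Subgraph),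
        LocChordal.IsGraphDecompositionIntoCliques G H bag K ∧
          LocChordal.LocallyInducesTreeDecompositions G bag K r,
      ∃ (N : Type u) (H : SimpleGraph N) (bag : N → Set V) (K : V → H.Subgraph),
        LocChordal.IsGraphDecompositionIntoCliques G H bag K ∧
          LocChordal.InducesLocalSeparations G H bag K r] := by
  tfae_have 1 → 5 := by
    intro h
    obtain ⟨N, H, bag, K, hD, hA, hK⟩ := LocChordal.exists_induced_decomposition hr h
    exact ⟨N, H, bag, K, hD, hD.inducesLocalSeparations (by omega) hA hK⟩
  tfae_have 5 → 3 := by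
    rintro ⟨N, H, bag, K, hD, hS⟩
    exact ⟨N, H, bag, K, hD, hS.isRAcyclic hD⟩
  tfae_have 3 → 2 := by
    rintro ⟨N, H, bag, K, hD, hA⟩
    exact ⟨N, H, K, hD.isRegionRepresentation, hA⟩
  tfae_have 2 → 3 := by
    rintro ⟨N, H, K, hR, hA⟩
    exact ⟨N, H, _, K, hR.isGraphDecompositionIntoCliques, hA⟩
  tfae_have 3 → 4 := by
    rintro ⟨N, H, bag, K, hD, hA⟩
    exact ⟨N, H, bag, K, hD, hD.locallyInducesTreeDecompositions (by omega) hA⟩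
  tfae_have 4 → 1 := by
    rintro ⟨N, H, bag, K, hD, hL⟩
    exact hL.isLocallyChordal hr hD
  tfae_finish
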